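/- Let $\mathcal{T}$ be a connected closed 3-manifold triangulation with $n$ tetrahedra: $n$ tetrahedra whose triangular faces are affinely glued together in pairs (faces of the same tetrahedron may be glued to each other), so that the resulting quotient space is a connected closed 3-manifold. Each tetrahedron $i$ has three quadrilateral types, one for each way of splitting its four vertices into two pairs; write $q_{i,j}$ ($1\le i\le n$, $1\le j\le 3$) for the corresponding coordinates of $\mathbb{R}^{3n}$. The *quadrilateral matching equations* of $\mathcal{T}$ consist of one homogeneous linear equation for each edge $e$ of $\mathcal{T}$: going once around $e$, with tetrahedra counted as often as they meet $e$, the sum of the coordinates of the quadrilateral types that slope upwards along $e$ equals the sum of those that slope downwards along $e$. The *quadrilateral projective solution space* $\mathscr{Q}\subseteq\mathbb{R}^{3n}$ is the polytope of all non-negative solutions of the quadrilateral matching equations with $\sum_{i,j} q_{i,j}=1$. A face $F$ of $\mathscr{Q}$ (the empty face, of dimension $-1$, and $\mathscr{Q}$ itself are included) is *admissible* if for every point of $F$ and every $i$ at most one of $q_{i,1},q_{i,2},q_{i,3}$ is non-zero, and a *maximal admissible face* if moreover it is not properly contained in another admissible face of $\mathscr{Q}$. If $\mathscr{Q}$ has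 a maximal admissible face $F$ of dimension $n-1$, then $F$ is the only maximal admissible face of $\mathscr{Q}$ (of any dimension). -/

import Mathlib

/-- Combinatorial data for `n` tetrahedra whose triangular faces are affinely glued in pairs.
The tetrahedra are indexed by `Fin n`, the vertices of each tetrahedron by `Fin 4`, and
"face `f`" of a tetrahedron is the face opposite to its vertex `f`.  Face `f` of tetrahedron `i`
is glued to a face of tetrahedron `adj i f`; the affine gluing map is determined by what it does
to vertices: it sends each vertex `v ≠ f` of tetrahedron `i` to the vertex `perm i f v` of
tetrahedron `adj i f`, so the partner of face `f` is face `perm i f f`.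
Gluings inside one tetrahedron are allowed; gluing a face to itself is not. -/
structure FaceGluing (n : ℕ) where
  adj : Fin n → Fin 4 → Fin n
  perm : Fin n → Fin 4 → Equiv.Perm (Fin 4)
  adj_adj : ∀ i f, adj (adj i f) (perm i f f) = i
  perm_perm : ∀ i f, perm (adj i f) (perm i f f) = (perm i f)⁻¹
  partner_ne : ∀ i f, (adj i f, perm i f f) ≠ (i, f)

/-- A closed 3-manifold: a compact separable metrizable space in which every point has an open
neighbourhood homeomorphic to `ℝ³`. -/
def IsClosedThreeManifold (X : Type*) [TopologicalSpace X] : Prop :=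
  CompactSpace X ∧ TopologicalSpace.MetrizableSpace X ∧ TopologicalSpace.SeparableSpace X ∧
    ∀ x : X, ∃ U : Set X, IsOpen U ∧ x ∈ U ∧ Nonempty (U ≃ₜ EuclideanSpace ℝ (Fin 3))

/-- The quadrilateral types of a tetrahedron correspond to the three ways of splitting its
vertices into two pairs: `0` is `{0,1} | {2,3}`, `1` is `{0,2} | {1,3}`, `2` is `{0,3} | {1,2}`.
For `a ≠ b`, `quadType a b` is the type that separates `{a, b}` from the other two vertices
(the diagonal entries are never used). -/
def quadType : Fin 4 → Fin 4 → Fin 3 :=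
  ![![0, 0, 1, 2],
    ![0, 0, 2, 1],
    ![1, 2, 0, 0],
    ![2, 1, 0, 0]]

/-- The space `ℝ^{3n}` of quadrilateral coordinates; `x (i, j)` is the coordinate of the `j`th
quadrilateral type in the `i`th tetrahedron. -/
abbrev QuadSpace (n : ℕ) : Type := Fin n × Fin 3 → ℝ

/-- The quadrilateral constraints: in each tetrahedron at most one of the three quadrilateral
coordinates is non-zero. -/
def QuadConstraints {n : ℕ} (x : QuadSpace n) : Prop :=
  ∀ (i : Fin n) (j k : Fin 3), x (i, j) ≠ 0 → x (i, k) ≠ 0 → j = k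

/-- The dimension of a convex set: that of its affine hull, with `dim ∅ = -1`. -/
noncomputable def convexDim {V : Type*} [AddCommGroup V] [Module ℝ V] (F : Set V) : ℤ :=
  open Classical in
  if F = ∅ then -1 else (Module.finrank ℝ (affineSpan ℝ F).direction : ℤ)

namespace FaceGluing

variable {n : ℕ} (T : FaceGluing n)

/-- The elementary identifications between points of the tetrahedra: a point `x` (in barycentric
coordinates) of face `f` of tetrahedron `i` is identified with its image under the gluing map. -/
def Glued (p q : Fin n × stdSimplex ℝ (Fin 4)) : Prop :=
  ∃ f : Fin 4, p.2 f = 0 ∧ q.1 = T.adj p.1 f ∧ ∀ v : Fin 4, q.2 (T.perm p.1 f v) = p.2 v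

/-- The topological space obtained by gluing the tetrahedra along their faces (with the quotient
topology; `Quot` passes to the generated equivalence relation). -/
def Space : Type := Quot T.Glued

instance : TopologicalSpace T.Space :=
  inferInstanceAs (TopologicalSpace (Quot T.Glued))

/-- `T` is a connected closed 3-manifold triangulation. -/
def IsConnectedClosedTriangulation : Prop :=
  IsClosedThreeManifold T.Space ∧ ConnectedSpace T.Space

/-- Walking around an edge.  The state `(i, p)` means that we are in tetrahedron `i`, next to its
edge directed from vertex `p 0` to vertex `p 1`, having entered through the face with vertices
`p 0, p 1, p 2`.  One step leaves through the face with vertices `p 0, p 1, p 3` (the one opposite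
to `p 2`) and enters the tetrahedron on the other side of it. -/
def step : Equiv.Perm (Fin n × Equiv.Perm (Fin 4)) where
  toFun s := (T.adj s.1 (s.2 2), T.perm s.1 (s.2 2) * s.2 * Equiv.swap 2 3)
  invFun s := (T.adj s.1 (s.2 3), T.perm s.1 (s.2 3) * s.2 * Equiv.swap 2 3)
  left_inv := by
    rintro ⟨i, p⟩
    have h3 : (Equiv.swap (2 : Fin 4) 3) 3 = 2 := by decide
    simp only [Equiv.Perm.mul_apply, h3, T.adj_adj, T.perm_perm]
    ext : 1
    · rfl
    · simp [mul_assoc]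
  right_inv := by
    rintro ⟨i, p⟩
    have h2 : (Equiv.swap (2 : Fin 4) 3) 2 = 3 := by decide
    simp only [Equiv.Perm.mul_apply, h2, T.adj_adj, T.perm_perm]
    ext : 1
    · rfl
    · simp [mul_assoc]

/-- The signed number of quadrilaterals met at one state of a walk around an edge from `p 0` to
`p 1`.  Along the walk, the quadrilaterals separating `{p 0, p 3}` from `{p 1, p 2}` slope in one
direction along the edge (they pass from an arc around `p 0` to an arc around `p 1`), those
separating `{p 0, p 2}` from `{p 1, p 3}` slope in the other direction, and the quadrilaterals of
the third type do not meet the edge. -/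
def slope (x : QuadSpace n) (s : Fin n × Equiv.Perm (Fin 4)) : ℝ :=
  x (s.1, quadType (s.2 0) (s.2 3)) - x (s.1, quadType (s.2 0) (s.2 2))

open Classical in
/-- Tollefson's quadrilateral matching equations: around each edge of the triangulation, the
quadrilaterals of positive slope and those of negative slope are equally many.  The sum runs over
one full turn around the edge, so a tetrahedron that meets the edge several times is counted that
many times.  (Each edge is listed once for every starting position, direction and sense of
rotation, which only repeats its equation up to sign.) -/
def MatchingEquations (x : QuadSpace n) : Prop :=
  ∀ s : Fin n × Equiv.Perm (Fin 4),
    ∑ s' : Fin n × Equiv.Perm (Fin 4) with T.step.SameCycle s s', slope x s' = 0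

/-- The quadrilateral projective solution space: the non-negative solutions of the matching
equations on the hyperplane where the coordinates sum to `1`. -/
def quadProjSolutionSpace : Set (QuadSpace n) :=
  {x | (∀ k, 0 ≤ x k) ∧ T.MatchingEquations x ∧ ∑ k, x k = 1}

/-- Admissible faces of the quadrilateral projective solution space: faces all of whose points
satisfy the quadrilateral constraints.  Faces of a polytope `P` are the empty set and the sets of
all maximisers on `P` of a linear functional (`P` itself among them), which is Mathlib's
`IsExposed ℝ P`. -/
def IsAdmissibleFace (F : Set (QuadSpace n)) : Prop :=
  IsExposed ℝ T.quadProjSolutionSpace F ∧ ∀ x ∈ F, QuadConstraints x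

/-- Maximal admissible faces: admissible faces not properly contained in another one. -/
def IsMaximalAdmissibleFace (F : Set (QuadSpace n)) : Prop :=
  Maximal T.IsAdmissibleFace F

end FaceGluing

/-!
# A maximal admissible face of dimension `n - 1` is the only one

Let `F` be an admissible face of dimension `n - 1`, so that it uses one quadrilateral type `τ i` in
each tetrahedron. Its linear span has dimension `n`, hence consists of *all* vectors supported on
the types `τ i`, and all of these solve the matching equations (`range_coordinateMap_le`). The
vectors that are constant on each tetrahedron are solutions too, and together the two families span
a space of dimension `2 n`. In a closed 3-manifold triangulation the solution space has dimension
at most `2 n` (`finrank_quadSolutions_le`), so there are no further solutions. Therefore every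
solution takes equal values on the two types of a tetrahedron other than `τ i`; if it is admissible,
both values are zero (`eq_zero_of_quadConstraints`). All admissible points thus lie in the face cut
out by the vanishing of the coordinates other than `τ i`, and this face is `F` by maximality.

The dimension bound compares the quadrilateral solutions with the solutions of the standard matching
equations, which have triangle coordinates as well.

* Along the link of a vertex, a quadrilateral solution determines the differences between the
  coordinates of adjacent triangles, and the quadrilateral matching equations say that they form a
  1-cocycle. So every quadrilateral solution extends to a standard one
  (`quadSolutions_le_map_standardSolutions`) if the first cohomology of the links vanishes. To see
  this for an integral cocycle, realise it by a circle-valued map on a punctured neighbourhood of the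
  vertex; punctured `ℝ³` being simply connected, the map lifts to `ℝ`
  (`exists_int_triangle_coords_at`).
* The vertex links themselves are standard solutions without quadrilaterals, so the dimension drops
  by at least the number `v` of vertices (`finrank_quadSolutions_add_card_vertex_le`).
* A standard solution is determined by its edge weights and one number per tetrahedron, so that the
  standard solutions have dimension at most `n + e`, where `e` is half of the number of directed
  edges (`finrank_standardSolutions_le`). This requires that no edge is identified with its reverse;
  otherwise a punctured neighbourhood of its midpoint would have a non-trivial double covering
  (`not_sameCycle_rev`).
* The directed edges are the vertices of the links, which have `4 n` triangles and `6 n` edges in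
  total. Closed surfaces have Euler characteristic at most twice the number of their components, so
  `2 e - 6 n + 4 n ≤ 2 v`, that is, `e - v ≤ n` (`card_directedEdge_le`).
-/

open Set Filter Topology

/-! ### Lifting through coverings near a manifold point -/

/-- An open star-shaped set is simply connected, so maps from it lift through coverings, with a
prescribed value at one point. -/
theorem IsCoveringMap.exists_lift_starConvex {V E B : Type*} [NormedAddCommGroup V]
    [NormedSpace ℝ V] [TopologicalSpace E] [TopologicalSpace B] {p : E → B}
    (cov : IsCoveringMap p) {S : Set V} {c : V} (hS : StarConvex ℝ c S) (hc : c ∈ S)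
    (ho : IsOpen S) {f : V → B} (hf : ContinuousOn f S) {x : V} (hx : x ∈ S) {e : E}
    (he : p e = f x) :
    ∃ F : V → E, ContinuousOn F S ∧ (∀ y ∈ S, p (F y) = f y) ∧ F x = e := by
  have : ContractibleSpace S := hS.contractibleSpace ⟨c, hc⟩
  have : LocallyPathConnectedSpace S := ho.locallyPathConnectedSpace
  obtain ⟨F, ⟨h1, h2⟩, -⟩ := cov.existsUnique_continuousMap_lifts
    ⟨S.domRestrict f, continuousOn_iff_continuous_domRestrict.1 hf⟩ (⟨x, hx⟩ : S) e he
  classical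
  refine ⟨fun y => if h : y ∈ S then F ⟨y, h⟩ else e, ?_, fun y hy => ?_, ?_⟩
  · rw [continuousOn_iff_continuous_domRestrict]
    convert F.continuous using 1
    ext y
    simp
  · simp only [hy, dif_pos]
    exact congr_fun h2 ⟨y, hy⟩
  · simp only [hx, dif_pos, h1]

/-- The complement of an axis in `ℝ³` is connected. -/
theorem isPreconnected_compl_axis :
    IsPreconnected {z : EuclideanSpace ℝ (Fin 3) | z 1 ≠ 0 ∨ z 2 ≠ 0} := by
  have hpos (i : Fin 3) : IsPreconnected {z : EuclideanSpace ℝ (Fin 3) | 0 < z i} :=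
    (convex_halfSpace_gt (EuclideanSpace.proj (𝕜 := ℝ) i).isLinear 0).isPreconnected
  have hneg (i : Fin 3) : IsPreconnected {z : EuclideanSpace ℝ (Fin 3) | z i < 0} :=
    (convex_halfSpace_lt (EuclideanSpace.proj (𝕜 := ℝ) i).isLinear 0).isPreconnected
  have h1 := (hpos 1).union' ⟨!₂[0, 1, 1], by simp⟩ (hpos 2)
  have h2 := h1.union' ⟨!₂[0, -1, 1], by simp⟩ (hneg 1)
  have h3 := h2.union' ⟨!₂[0, 1, -1], by simp⟩ (hneg 2)
  convert h3 using 1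
  ext z
  simp only [mem_ofPred_eq, mem_union, ne_iff_lt_or_gt]
  tauto

/-- Punctured `ℝ³` is the union of two open star-shaped sets (the complements of two opposite
rays) with connected intersection, so every map from it lifts through a covering. -/
theorem IsCoveringMap.exists_lift_punctured {E B : Type*} [TopologicalSpace E]
    [TopologicalSpace B] {p : E → B} (cov : IsCoveringMap p) (hp : Function.Surjective p)
    {f : EuclideanSpace ℝ (Fin 3) → B} (hf : ContinuousOn f {0}ᶜ) :
    ∃ F : EuclideanSpace ℝ (Fin 3) → E, ContinuousOn F {0}ᶜ ∧ ∀ y, y ≠ 0 → p (F y) = f y := by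
  -- `A 1` and `A (-1)` are the complements of two opposite rays
  set A : ℝ → Set (EuclideanSpace ℝ (Fin 3)) := fun ε => {z | 0 < ε * z 0 ∨ z 1 ≠ 0 ∨ z 2 ≠ 0}
    with hA
  have hAo (ε : ℝ) : IsOpen (A ε) := by
    have h0 : IsOpen {z : EuclideanSpace ℝ (Fin 3) | 0 < ε * z 0} :=
      isOpen_lt continuous_const (by fun_prop)
    have h (i : Fin 3) : IsOpen {z : EuclideanSpace ℝ (Fin 3) | z i ≠ 0} :=
      isOpen_ne_fun (by fun_prop) continuous_const
    exact h0.union ((h 1).union (h 2))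
  have hAc (ε : ℝ) (hε : ε * ε = 1) : (!₂[ε, 0, 0] : EuclideanSpace ℝ (Fin 3)) ∈ A ε := by
    left; simp [hε]
  have hAs (ε : ℝ) (hε : ε * ε = 1) :
      StarConvex ℝ (!₂[ε, 0, 0] : EuclideanSpace ℝ (Fin 3)) (A ε) := by
    intro y hy a b ha hb hab
    rcases hb.eq_or_lt with rfl | hb
    · have : a = 1 := by linarith
      subst this
      simpa using hAc ε hε
    · rcases hy with hy | hy | hy
      · left
        simp only [PiLp.add_apply, PiLp.smul_apply, smul_eq_mul]
        have : ε * (a * (!₂[ε, 0, 0] : EuclideanSpace ℝ (Fin 3)) 0 + b * y 0)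
            = a * (ε * ε) + b * (ε * y 0) := by
          simp; ring
        rw [this, hε]
        have := mul_pos hb hy
        linarith
      · right; left
        simp [hy, hb.ne']
      · right; right
        simp [hy, hb.ne']
  have hA0 (ε : ℝ) : A ε ⊆ {0}ᶜ := by
    rintro y hy rfl
    simp [hA] at hy
  have hx (ε : ℝ) : (!₂[0, 1, 0] : EuclideanSpace ℝ (Fin 3)) ∈ A ε := by
    right; left; simp
  obtain ⟨e, he⟩ := hp (f !₂[0, 1, 0])
  obtain ⟨F₁, c₁, l₁, b₁⟩ := cov.exists_lift_starConvex (hAs 1 (by norm_num)) (hAc 1 (by norm_num))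
    (hAo 1) (hf.mono (hA0 1)) (hx 1) he
  obtain ⟨F₂, c₂, l₂, b₂⟩ := cov.exists_lift_starConvex (hAs (-1) (by norm_num))
    (hAc (-1) (by norm_num)) (hAo (-1)) (hf.mono (hA0 (-1))) (hx (-1)) he
  have hs1 : {z : EuclideanSpace ℝ (Fin 3) | z 1 ≠ 0 ∨ z 2 ≠ 0} ⊆ A 1 := fun z hz => Or.inr hz
  have hs2 : {z : EuclideanSpace ℝ (Fin 3) | z 1 ≠ 0 ∨ z 2 ≠ 0} ⊆ A (-1) := fun z hz => Or.inr hz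
  have heq : EqOn F₁ F₂ {z | z 1 ≠ 0 ∨ z 2 ≠ 0} :=
    cov.eqOn_of_comp_eqOn isPreconnected_compl_axis (c₁.mono hs1) (c₂.mono hs2)
      (fun z hz => (l₁ z (hs1 hz)).trans (l₂ z (hs2 hz)).symm)
      (a := !₂[0, 1, 0]) (by simp) (b₁.trans b₂.symm)
  have heq' : EqOn F₁ F₂ (A 1 ∩ A (-1)) := by
    rintro z ⟨h1, h2⟩
    apply heq
    rcases h1 with h1 | h1
    · rcases h2 with h2 | h2
      · linarith
      · exact h2
    · exact h1
  classical
  have hcov (y : EuclideanSpace ℝ (Fin 3)) (hy : y ≠ 0) : y ∈ A 1 ∨ y ∈ A (-1) := by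
    by_contra! h
    apply hy
    simp only [hA, mem_ofPred_eq, not_or, not_lt, not_ne_iff] at h
    ext i
    fin_cases i <;> simp <;> linarith
  refine ⟨(A 1).piecewise F₁ F₂, ?_, fun y hy => ?_⟩
  · intro y hy
    apply ContinuousAt.continuousWithinAt
    rcases hcov y hy with h | h
    · refine (c₁.continuousAt ((hAo 1).mem_nhds h)).congr ?_
      filter_upwards [(hAo 1).mem_nhds h] with z hz
      simp [hz]
    · refine (c₂.continuousAt ((hAo (-1)).mem_nhds h)).congr ?_
      filter_upwards [(hAo (-1)).mem_nhds h] with z hz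
      by_cases hz1 : z ∈ A 1
      · simp [hz1, heq' ⟨hz1, hz⟩]
      · simp [hz1]
  · by_cases h : y ∈ A 1
    · simp [h, l₁ y h]
    · simp [h, l₂ y ((hcov y hy).resolve_left h)]

/-- A map into the base of a covering that is defined near a point of a 3-manifold, but not at
the point itself, lifts on a smaller punctured neighbourhood. -/
theorem IsCoveringMap.exists_local_lift {X E B : Type*} [TopologicalSpace X] [TopologicalSpace E]
    [TopologicalSpace B] (hX : IsClosedThreeManifold X) {p : E → B} (cov : IsCoveringMap p)
    (hp : Function.Surjective p) {N : Set X} (hN : IsOpen N) {x : X} (hx : x ∈ N) {g : X → B}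
    (hg : ContinuousOn g (N \ {x})) :
    ∃ U : Set X, IsOpen U ∧ x ∈ U ∧
      ∃ h : X → E, ContinuousOn h (U \ {x}) ∧ ∀ y ∈ U \ {x}, p (h y) = g y := by
  obtain ⟨-, -, -, hX⟩ := hX
  obtain ⟨U, hUo, hxU, ⟨φ⟩⟩ := hX x
  set c := φ ⟨x, hxU⟩ with hc
  -- a small ball around the point in a chart is itself homeomorphic to `ℝ³`
  have hNo : IsOpen {z : EuclideanSpace ℝ (Fin 3) | ((φ.symm z : U) : X) ∈ N} :=
    hN.preimage (by fun_prop)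
  obtain ⟨r, hr, hball⟩ := Metric.isOpen_iff.1 hNo c (by simpa [hc] using hx)
  set ψ := OpenPartialHomeomorph.univBall c r with hψ
  have hψt : ψ.target = Metric.ball c r := OpenPartialHomeomorph.univBall_target c hr
  have hψs : ψ.source = univ := OpenPartialHomeomorph.univBall_source c r
  have hψb (z) : ψ z ∈ Metric.ball c r := hψt ▸ ψ.map_source (by simp [hψs])
  have hψc : Continuous ψ := OpenPartialHomeomorph.continuous_univBall c r
  have hf : ContinuousOn (fun z => g (φ.symm (ψ z))) {0}ᶜ := by
    refine hg.comp (f := fun z => ((φ.symm (ψ z) : U) : X)) (by fun_prop) fun z hz => ?_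
    refine ⟨hball (hψb z), fun h => hz ?_⟩
    have h1 : φ.symm (ψ z) = ⟨x, hxU⟩ := Subtype.ext h
    have h2 : ψ z = ψ 0 := by
      rw [OpenPartialHomeomorph.univBall_apply_zero, hc, ← h1, φ.apply_symm_apply]
    exact ψ.injOn (by simp [hψs]) (by simp [hψs]) h2
  obtain ⟨F, hF, hFl⟩ := cov.exists_lift_punctured hp hf
  classical
  have hVo : IsOpen ((↑) '' (φ ⁻¹' Metric.ball c r) : Set X) :=
    hUo.isOpenMap_subtype_val _ (Metric.isOpen_ball.preimage φ.continuous)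
  refine ⟨_, hVo, ⟨⟨x, hxU⟩, by simp [← hc, hr], rfl⟩,
    fun y => if hy : y ∈ U then F (ψ.symm (φ ⟨y, hy⟩)) else F 0, ?_, ?_⟩
  · have hne (y : U) (hy : y ∈ φ ⁻¹' Metric.ball c r) (hyx : (y : X) ≠ x) :
        ψ.symm (φ y) ≠ 0 := by
      intro h
      apply hyx
      have h1 : ψ (ψ.symm (φ y)) = c := by rw [h, OpenPartialHomeomorph.univBall_apply_zero]
      rw [ψ.right_inv (hψt ▸ hy), hc] at h1
      exact congr_arg Subtype.val (φ.injective h1)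
    rintro _ ⟨⟨y, hy, rfl⟩, hyx⟩
    apply ContinuousAt.continuousWithinAt
    have key : ContinuousAt (fun y : U => F (ψ.symm (φ y))) y := by
      refine ContinuousAt.comp (g := F) (hF.continuousAt (isOpen_compl_singleton.mem_nhds
        (hne y hy hyx))) ?_
      exact ContinuousAt.comp (g := ψ.symm) (ψ.symm.continuousAt (by simpa [hψt] using hy))
        φ.continuous.continuousAt
    rw [← hUo.isOpenEmbedding_subtypeVal.continuousAt_iff]
    convert key using 2 with z
    simp
  · rintro _ ⟨⟨y, hy, rfl⟩, hyx⟩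
    simp only [y.2, dif_pos]
    rw [hFl]
    · simp only [ψ.right_inv (show φ y ∈ ψ.target from hψt ▸ hy), φ.symm_apply_apply,
        Subtype.coe_eta]
    · intro h
      apply hyx
      have h1 : ψ (ψ.symm (φ y)) = c := by
        rw [show ψ.symm (φ y) = 0 from h, OpenPartialHomeomorph.univBall_apply_zero]
      rw [ψ.right_inv (hψt ▸ hy), hc] at h1
      exact congr_arg Subtype.val (φ.injective h1)

/-! ### The quotient space of a face gluing -/

/-- Relabelling the vertices of the standard tetrahedron. -/
def relabel (σ : Equiv.Perm (Fin 4)) (x : stdSimplex ℝ (Fin 4)) :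
    stdSimplex ℝ (Fin 4) :=
  ⟨fun v => x (σ.symm v), fun v => x.2.1 _,
    by rw [← x.2.2]; exact Equiv.sum_comp σ.symm (fun v => x.1 v)⟩

@[simp] theorem relabel_apply (σ : Equiv.Perm (Fin 4)) (x : stdSimplex ℝ (Fin 4))
    (v : Fin 4) : relabel σ x (σ v) = x v := by
  change x (σ.symm (σ v)) = x v
  simp

theorem continuous_coord (v : Fin 4) :
    Continuous fun x : stdSimplex ℝ (Fin 4) => x v :=
  (continuous_apply v).comp continuous_subtype_val

/-- Conditions on barycentric coordinates that do not depend on the labelling of the vertices. -/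
def RelabelInvariant (P : (Fin 4 → ℝ) → Prop) : Prop :=
  ∀ (σ : Equiv.Perm (Fin 4)) (y : Fin 4 → ℝ), P y → P fun v => y (σ v)

namespace FaceGluing

variable {n : ℕ} (T : FaceGluing n)

/-- The point of the glued space given by a point of one of the tetrahedra. -/
def toSpace (p : Fin n × stdSimplex ℝ (Fin 4)) : T.Space := Quot.mk T.Glued p

theorem isQuotientMap_toSpace : IsQuotientMap T.toSpace := isQuotientMap_quot_mk

variable {T}

theorem glued_relabel {i : Fin n} {f : Fin 4} {x : stdSimplex ℝ (Fin 4)} (hx : x f = 0) :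
    T.Glued (i, x) (T.adj i f, relabel (T.perm i f) x) :=
  ⟨f, hx, rfl, fun _ => relabel_apply _ _ _⟩

theorem Glued.prop_iff {P : (Fin 4 → ℝ) → Prop} (hP : RelabelInvariant P)
    {p q : Fin n × stdSimplex ℝ (Fin 4)} (h : T.Glued p q) : P p.2 ↔ P q.2 := by
  obtain ⟨f, -, -, h⟩ := h
  constructor
  · intro hp
    convert hP (T.perm p.1 f).symm _ hp using 2 with v
    rw [← h, Equiv.apply_symm_apply]
  · intro hq
    convert hP (T.perm p.1 f) _ hq using 2 with v
    rw [← h]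

theorem prop_iff_of_toSpace_eq {P : (Fin 4 → ℝ) → Prop} (hP : RelabelInvariant P)
    {p q : Fin n × stdSimplex ℝ (Fin 4)} (h : T.toSpace p = T.toSpace q) : P p.2 ↔ P q.2 := by
  have h' : Relation.EqvGen T.Glued p q := Quot.eqvGen_exact h
  clear h
  induction h' with
  | rel _ _ h => exact h.prop_iff hP
  | refl _ => exact Iff.rfl
  | symm _ _ _ ih => exact ih.symm
  | trans _ _ _ _ _ ih1 ih2 => exact ih1.trans ih2

/-- Lifting through a covering near a point of the glued space, expressed on the tetrahedra.
`Pn` describes a region and `Ps` the finitely many special points in it where the map `G` is not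
required to be continuous. -/
theorem exists_local_lift {E B : Type*} [TopologicalSpace E] [TopologicalSpace B]
    (hT : IsClosedThreeManifold T.Space) {c : E → B} (cov : IsCoveringMap c)
    (hc : Function.Surjective c) {Pn Ps : (Fin 4 → ℝ) → Prop} (hPn : RelabelInvariant Pn)
    (hPs : RelabelInvariant Ps) (hPno : IsOpen {y | Pn y})
    (hPsf : {x : stdSimplex ℝ (Fin 4) | Ps x}.Finite)
    {G : Fin n × stdSimplex ℝ (Fin 4) → B} (hG : ∀ p q, T.Glued p q → G p = G q)
    (hGc : ContinuousOn G {p | Pn p.2 ∧ ¬ Ps p.2})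
    {p₀ : Fin n × stdSimplex ℝ (Fin 4)} (hn : Pn p₀.2) (hs : Ps p₀.2) :
    ∃ V : Set (Fin n × stdSimplex ℝ (Fin 4)), IsOpen V ∧ (∀ p, T.toSpace p = T.toSpace p₀ → p ∈ V) ∧
      ∃ H : Fin n × stdSimplex ℝ (Fin 4) → E, ContinuousOn H {p | p ∈ V ∧ ¬ Ps p.2} ∧
        (∀ p ∈ V, ¬ Ps p.2 → c (H p) = G p) ∧ ∀ p q, T.Glued p q → H p = H q := by
  have : TopologicalSpace.MetrizableSpace T.Space := hT.2.1
  have hmkc : Continuous T.toSpace := T.isQuotientMap_toSpace.continuous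
  have mem_iff {P : (Fin 4 → ℝ) → Prop} (hP : RelabelInvariant P)
      (p : Fin n × stdSimplex ℝ (Fin 4)) : T.toSpace p ∈ T.toSpace '' {p | P p.2} ↔ P p.2 :=
    ⟨fun ⟨q, hq, h⟩ => (prop_iff_of_toSpace_eq hP h).1 hq, fun h => ⟨p, h, rfl⟩⟩
  set N := T.toSpace '' {p | Pn p.2}
  set S := T.toSpace '' {p | Ps p.2}
  have hNo : IsOpen N := by
    rw [← T.isQuotientMap_toSpace.isOpen_preimage]
    convert hPno.preimage (continuous_subtype_val.comp continuous_snd :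
      Continuous fun p : Fin n × stdSimplex ℝ (Fin 4) => (p.2 : Fin 4 → ℝ)) using 1
    ext p
    exact mem_iff hPn p
  have hSf : S.Finite := by
    refine Set.Finite.image _ ((Set.finite_univ.prod hPsf).subset fun p hp => ⟨mem_univ _, hp⟩)
  let g : T.Space → B := Quot.lift G hG
  have hg : ContinuousOn g (N \ S) := by
    rw [T.isQuotientMap_toSpace.continuousOn_isOpen_iff (hNo.sdiff hSf.isClosed)]
    refine hGc.mono fun p hp => ⟨(mem_iff hPn p).1 hp.1, fun h => hp.2 ((mem_iff hPs p).2 h)⟩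
  -- discard the other special points from the region
  have hsub : (N \ (S \ {T.toSpace p₀})) \ {T.toSpace p₀} = N \ S := by
    have : T.toSpace p₀ ∈ S := (mem_iff hPs p₀).2 hs
    ext y
    simp only [Set.mem_sdiff, mem_singleton_iff]
    constructor
    · tauto
    · rintro ⟨h1, h2⟩
      exact ⟨⟨h1, fun h => h2 h.1⟩, fun h => h2 (h ▸ this)⟩
  obtain ⟨U, hUo, hxU, h, hh, hl⟩ := cov.exists_local_lift hT hc
    (hNo.sdiff (hSf.subset sdiff_subset).isClosed : IsOpen (N \ (S \ {T.toSpace p₀})))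
    ⟨(mem_iff hPn p₀).2 hn, fun h => h.2 rfl⟩ (by rwa [hsub])
  have hne {p : Fin n × stdSimplex ℝ (Fin 4)} (hp : ¬ Ps p.2) : T.toSpace p ≠ T.toSpace p₀ :=
    fun h => hp ((prop_iff_of_toSpace_eq hPs h).2 hs)
  refine ⟨T.toSpace ⁻¹' U, hUo.preimage hmkc, fun p hp => by rwa [mem_preimage, hp], h ∘ T.toSpace,
    hh.comp hmkc.continuousOn fun p hp => ⟨hp.1, hne hp.2⟩,
    fun p hp hps => hl _ ⟨hp, hne hps⟩, fun p q hpq => ?_⟩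
  exact congr_arg h (Quot.sound hpq)

end FaceGluing

/-! ### Walking around edges -/

/-- A function with zero sum over every cycle of a permutation is a coboundary: `θ` is minus the
average over a full period of the partial sums of the function. -/
theorem Equiv.Perm.exists_potential {S : Type*} [Fintype S] (σ : Equiv.Perm S) (a : S → ℝ)
    (ha : ∀ s, open Classical in ∑ s' with σ.SameCycle s s', a s' = 0) :
    ∃ θ : S → ℝ, ∀ s, θ (σ s) = θ s + a s := by
  classical
  set N := orderOf σ with hN
  have hN0 : 0 < N := orderOf_pos σ
  have hσN (s : S) : (σ ^ N) s = s := by rw [hN, pow_orderOf_eq_one]; rfl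
  set A : ℕ → S → ℝ := fun k s => ∑ j ∈ Finset.range k, a ((σ ^ j) s) with hA
  have hstep (k : ℕ) (s : S) : A k (σ s) = A (k + 1) s - a s := by
    simp only [hA, Finset.sum_range_succ']
    simp [pow_succ]
  have hinv (s : S) : A N (σ s) = A N s := by
    rw [hstep]
    simp only [hA, Finset.sum_range_succ, hσN]
    ring
  have hcyc (s s' : S) (h : σ.SameCycle s s') : A N s' = A N s := by
    obtain ⟨k, -, rfl⟩ := h.exists_pow_eq'
    clear h
    induction k with
    | zero => rfl
    | succ k ih => rw [pow_succ', Equiv.Perm.mul_apply, hinv, ih]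
  have hsum (s : S) (j : ℕ) : ∑ s' with σ.SameCycle s s', a ((σ ^ j) s') = 0 := by
    rw [← ha s]
    refine Finset.sum_equiv (σ ^ j) (fun s' => ?_) fun _ _ => rfl
    simp
  -- a sum over a full period is a multiple of the sum over the cycle
  have hzero (s : S) : A N s = 0 := by
    have h1 : ∑ s' with σ.SameCycle s s', A N s' = 0 := by
      simp only [hA]
      rw [Finset.sum_comm]
      exact Finset.sum_eq_zero fun j _ => hsum s j
    rw [Finset.sum_congr rfl fun s' hs' => hcyc s s' (by simpa using hs'), Finset.sum_const,
      smul_eq_zero] at h1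
    refine h1.resolve_left (Finset.card_ne_zero.2 ⟨s, by simpa using Equiv.Perm.SameCycle.refl σ s⟩)
  refine ⟨fun s => -(∑ k ∈ Finset.range N, A k s) / N, fun s => ?_⟩
  have h2 : ∑ k ∈ Finset.range N, A k (σ s) = ∑ k ∈ Finset.range N, A k s - N * a s := by
    simp only [hstep, Finset.sum_sub_distrib, Finset.sum_const, Finset.card_range, nsmul_eq_mul]
    have h3 := Finset.sum_range_succ' (fun k => A k s) N
    rw [Finset.sum_range_succ, hzero] at h3
    have h4 : A 0 s = 0 := by simp [hA]
    linarith
  simp only [h2]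
  have : (N : ℝ) ≠ 0 := by exact_mod_cast hN0.ne'
  field_simp
  ring

namespace FaceGluing

variable {n : ℕ} (T : FaceGluing n)

/-- The state of a walk around an edge with the sense of rotation reversed. -/
def flip (s : Fin n × Equiv.Perm (Fin 4)) : Fin n × Equiv.Perm (Fin 4) :=
  (s.1, s.2 * Equiv.swap 2 3)

/-- The state of a walk around an edge with the direction of the edge reversed. -/
def rev (s : Fin n × Equiv.Perm (Fin 4)) : Fin n × Equiv.Perm (Fin 4) :=
  (s.1, s.2 * Equiv.swap 0 1)

@[simp] theorem flip_flip (s : Fin n × Equiv.Perm (Fin 4)) : flip (flip s) = s := by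
  simp [flip, mul_assoc]

@[simp] theorem rev_rev (s : Fin n × Equiv.Perm (Fin 4)) : rev (rev s) = s := by
  simp [rev, mul_assoc]

theorem flip_rev (s : Fin n × Equiv.Perm (Fin 4)) : flip (rev s) = rev (flip s) := by
  have : Equiv.swap (0 : Fin 4) 1 * Equiv.swap 2 3 = Equiv.swap 2 3 * Equiv.swap 0 1 := by decide
  simp [rev, flip, mul_assoc, this]

theorem rev_ne (s : Fin n × Equiv.Perm (Fin 4)) : rev s ≠ s := by
  intro h
  have := congr_arg (fun s => s.2 0) h
  simp [rev] at this

theorem rev_ne_flip (s : Fin n × Equiv.Perm (Fin 4)) : rev s ≠ flip s := by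
  intro h
  have := congr_arg (fun s => s.2 0) h
  have h2 : Equiv.swap (2 : Fin 4) 3 0 = 0 := by decide
  simp [rev, flip, h2] at this

theorem step_flip (s : Fin n × Equiv.Perm (Fin 4)) : T.step (flip s) = flip (T.step.symm s) := by
  have h : Equiv.swap (2 : Fin 4) 3 2 = 3 := by decide
  simp [step, flip, h, mul_assoc]

theorem step_rev (s : Fin n × Equiv.Perm (Fin 4)) : T.step (rev s) = rev (T.step s) := by
  have h : Equiv.swap (0 : Fin 4) 1 2 = 2 := by decide
  have h' : Equiv.swap (0 : Fin 4) 1 * Equiv.swap 2 3 = Equiv.swap 2 3 * Equiv.swap 0 1 := by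
    decide
  simp [step, rev, h, mul_assoc, h']

/-- Turning around after a step and stepping again leads back through the same face. -/
theorem step_flip_step (s : Fin n × Equiv.Perm (Fin 4)) : T.step (flip (T.step s)) = flip s := by
  rw [step_flip, Equiv.symm_apply_apply]

theorem step_fst (s : Fin n × Equiv.Perm (Fin 4)) : (T.step s).1 = T.adj s.1 (s.2 2) := rfl

theorem step_zero (s : Fin n × Equiv.Perm (Fin 4)) :
    (T.step s).2 0 = T.perm s.1 (s.2 2) (s.2 0) := by
  have h : Equiv.swap (2 : Fin 4) 3 0 = 0 := by decide
  simp [step, h]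

theorem step_one (s : Fin n × Equiv.Perm (Fin 4)) :
    (T.step s).2 1 = T.perm s.1 (s.2 2) (s.2 1) := by
  have h : Equiv.swap (2 : Fin 4) 3 1 = 1 := by decide
  simp [step, h]

theorem step_two (s : Fin n × Equiv.Perm (Fin 4)) :
    (T.step s).2 2 = T.perm s.1 (s.2 2) (s.2 3) := by
  simp [step]

theorem step_three (s : Fin n × Equiv.Perm (Fin 4)) :
    (T.step s).2 3 = T.perm s.1 (s.2 2) (s.2 2) := by
  simp [step]

@[simp] theorem flip_fst (s : Fin n × Equiv.Perm (Fin 4)) : (flip s).1 = s.1 := rfl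
@[simp] theorem flip_zero (s : Fin n × Equiv.Perm (Fin 4)) : (flip s).2 0 = s.2 0 := by
  have h : Equiv.swap (2 : Fin 4) 3 0 = 0 := by decide
  simp [flip, h]
@[simp] theorem flip_one (s : Fin n × Equiv.Perm (Fin 4)) : (flip s).2 1 = s.2 1 := by
  have h : Equiv.swap (2 : Fin 4) 3 1 = 1 := by decide
  simp [flip, h]
@[simp] theorem flip_two (s : Fin n × Equiv.Perm (Fin 4)) : (flip s).2 2 = s.2 3 := by
  simp [flip]
@[simp] theorem flip_three (s : Fin n × Equiv.Perm (Fin 4)) : (flip s).2 3 = s.2 2 := by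
  simp [flip]
@[simp] theorem rev_fst (s : Fin n × Equiv.Perm (Fin 4)) : (rev s).1 = s.1 := rfl
@[simp] theorem rev_zero (s : Fin n × Equiv.Perm (Fin 4)) : (rev s).2 0 = s.2 1 := by
  simp [rev]
@[simp] theorem rev_one (s : Fin n × Equiv.Perm (Fin 4)) : (rev s).2 1 = s.2 0 := by
  simp [rev]
@[simp] theorem rev_two (s : Fin n × Equiv.Perm (Fin 4)) : (rev s).2 2 = s.2 2 := by
  have h : Equiv.swap (0 : Fin 4) 1 2 = 2 := by decide
  simp [rev, h]
@[simp] theorem rev_three (s : Fin n × Equiv.Perm (Fin 4)) : (rev s).2 3 = s.2 3 := by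
  have h : Equiv.swap (0 : Fin 4) 1 3 = 3 := by decide
  simp [rev, h]

/-- The difference between the numbers of quadrilaterals that cut off the vertex `p 0` from the
face opposite to `p 2`, seen from the two sides of that face. -/
def arcJump (x : QuadSpace n) (s : Fin n × Equiv.Perm (Fin 4)) : ℝ :=
  x (s.1, quadType (s.2 0) (s.2 2)) - x ((T.step s).1, quadType ((T.step s).2 0) ((T.step s).2 3))

variable {T}

/-- Crossing a face back changes the sign of the jump. -/
theorem arcJump_flip_step (x : QuadSpace n) (s : Fin n × Equiv.Perm (Fin 4)) :
    T.arcJump x (flip (T.step s)) = - T.arcJump x s := by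
  simp [arcJump, step_flip_step]

/-- The matching equations say that the jumps across faces add up to zero around every edge, so
they are the increments of a function on the states. -/
theorem MatchingEquations.exists_potential {x : QuadSpace n} (hx : T.MatchingEquations x) :
    ∃ θ : Fin n × Equiv.Perm (Fin 4) → ℝ, (∀ s, θ (T.step s) = θ s + T.arcJump x s) ∧
      ∀ s, θ (flip s) = θ s := by
  classical
  obtain ⟨θ, hθ⟩ := T.step.exists_potential (T.arcJump x) fun s => by
    have h1 : ∑ s' with T.step.SameCycle s s',
        x ((T.step s').1, quadType ((T.step s').2 0) ((T.step s').2 3)) =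
        ∑ s' with T.step.SameCycle s s', x (s'.1, quadType (s'.2 0) (s'.2 3)) :=
      Finset.sum_equiv T.step (fun s' => by simp) fun _ _ => rfl
    have h2 : ∑ s' with T.step.SameCycle s s', slope x s' = 0 := by convert hx s
    have h3 : ∑ s' with T.step.SameCycle s s', T.arcJump x s' = 0 := by
      simp only [slope, Finset.sum_sub_distrib] at h2
      simp only [arcJump, Finset.sum_sub_distrib, h1]
      linarith
    convert h3
  -- `fun s => θ (flip s)` is a second potential; the average is symmetric
  refine ⟨fun s => (θ s + θ (flip s)) / 2, fun s => ?_, fun s => by simp [add_comm]⟩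
  have h1 := hθ (flip (T.step s))
  rw [step_flip_step, arcJump_flip_step] at h1
  simp only [hθ s]
  linarith

end FaceGluing

/-! ### Vertex links have no first cohomology -/

theorem isPreconnected_stdSimplex_of_convex {K : Set (Fin 4 → ℝ)} (hK : Convex ℝ K) :
    IsPreconnected {x : stdSimplex ℝ (Fin 4) | (x : Fin 4 → ℝ) ∈ K} := by
  rw [← Topology.IsInducing.subtypeVal.isPreconnected_image]
  convert ((convex_stdSimplex ℝ (Fin 4)).inter hK).isPreconnected using 1
  ext y
  constructor
  · rintro ⟨x, hx, rfl⟩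
    exact ⟨x.2, hx⟩
  · rintro ⟨h1, h2⟩
    exact ⟨⟨y, h1⟩, h2, rfl⟩

/-- The point of the edge from `v` to `w` with barycentric coordinates `1 - δ` and `δ`. -/
def edgePoint {v w : Fin 4} (hvw : v ≠ w) {δ : ℝ} (h0 : 0 ≤ δ) (h1 : δ ≤ 1) :
    stdSimplex ℝ (Fin 4) :=
  ⟨fun u => if u = v then 1 - δ else if u = w then δ else 0, fun u => by
    dsimp only
    split_ifs <;> linarith, by
    rw [← Finset.add_sum_erase _ _ (Finset.mem_univ v), ← Finset.add_sum_erase _ _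
      (Finset.mem_erase.2 ⟨hvw.symm, Finset.mem_univ w⟩), Finset.sum_eq_zero]
    · simp [hvw.symm]
    · intro u hu
      simp only [Finset.mem_erase] at hu
      simp [hu.1, hu.2.1]⟩

theorem edgePoint_apply {v w : Fin 4} (hvw : v ≠ w) {δ : ℝ} (h0 : 0 ≤ δ) (h1 : δ ≤ 1)
    (u : Fin 4) : edgePoint hvw h0 h1 u = if u = v then 1 - δ else if u = w then δ else 0 := rfl

theorem stdSimplex_add_le_one (x : stdSimplex ℝ (Fin 4)) {v w : Fin 4} (h : v ≠ w) :
    x v + x w ≤ 1 := by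
  have := Finset.sum_le_sum_of_subset_of_nonneg (Finset.subset_univ {v, w})
    fun i _ _ => x.2.1 i
  rw [Finset.sum_pair h, x.2.2] at this
  exact this

theorem ne_add_one : ∀ v : Fin 4, v ≠ v + 1 := by decide

theorem exists_third : ∀ v f : Fin 4, ∃ w, v ≠ w ∧ w ≠ f := by decide

/-- Every `w ≠ v` is the second entry of two permutations that start with `v`. -/
theorem sum_perm_eq_sum_compl (v : Fin 4) (y : Fin 4 → ℝ) :
    ∑ p : Equiv.Perm (Fin 4), (if p 0 = v then y (p 1) else 0) = 2 * (∑ w, y w - y v) := by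
  have h1 (p : Equiv.Perm (Fin 4)) : (if p 0 = v then y (p 1) else 0) =
      ∑ w, if p 0 = v ∧ p 1 = w then y w else 0 := by
    by_cases h : p 0 = v <;> simp [h]
  have h2 : ∀ v w : Fin 4, (Finset.univ.filter
      fun p : Equiv.Perm (Fin 4) => p 0 = v ∧ p 1 = w).card = if w = v then 0 else 2 := by
    decide
  simp only [h1]
  rw [Finset.sum_comm]
  simp only [← Finset.sum_filter, Finset.sum_const, h2]
  simp [ite_smul, Finset.sum_ite, Finset.filter_ne', ← Finset.mul_sum]

theorem isOpen_vertexNhd : IsOpen {y : Fin 4 → ℝ | ∃ v, 1 / 2 < y v} := by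
  have : {y : Fin 4 → ℝ | ∃ v, 1 / 2 < y v} = ⋃ v, {y : Fin 4 → ℝ | 1 / 2 < y v} := by
    ext; simp
  rw [this]
  exact isOpen_iUnion fun v => isOpen_lt continuous_const (continuous_apply v)

theorem stdSimplex_eq_of_eq_one {x y : stdSimplex ℝ (Fin 4)} {v : Fin 4} (hx : x v = 1)
    (hy : y v = 1) : x = y := by
  have key (x : stdSimplex ℝ (Fin 4)) (hx : x v = 1) (w : Fin 4) (hw : w ≠ v) : x w = 0 := by
    have := stdSimplex_add_le_one x hw
    have h0 : 0 ≤ x w := x.2.1 w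
    linarith
  apply Subtype.ext
  funext w
  by_cases hw : w = v
  · subst hw; exact hx.trans hy.symm
  · exact (key x hx w hw).trans (key y hy w hw).symm

namespace FaceGluing

variable {n : ℕ} (T : FaceGluing n)

/-- Near a vertex of a tetrahedron, interpolate linearly between values given on the edges at
this vertex; the value on the edge from `p 0` to `p 1` of tetrahedron `i` is `θ (i, p)`.  Each of
these edges occurs for two permutations `p`, whence the factor `2`.  The value at the vertex
itself is `0`, and so is the value away from the vertices. -/
noncomputable def interpolation (θ : Fin n × Equiv.Perm (Fin 4) → ℝ)
    (q : Fin n × stdSimplex ℝ (Fin 4)) : ℝ :=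
  ∑ p : Equiv.Perm (Fin 4),
    if 1 / 2 < q.2 (p 0) then q.2 (p 1) * θ (q.1, p) / (2 * (1 - q.2 (p 0))) else 0

/-- At most one coordinate exceeds `1 / 2`. -/
theorem interpolation_eq (θ : Fin n × Equiv.Perm (Fin 4) → ℝ) {q : Fin n × stdSimplex ℝ (Fin 4)}
    {v : Fin 4} (hv : 1 / 2 < q.2 v) :
    interpolation θ q = (∑ p : Equiv.Perm (Fin 4), if p 0 = v then q.2 (p 1) * θ (q.1, p) else 0) /
      (2 * (1 - q.2 v)) := by
  rw [interpolation, Finset.sum_div]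
  refine Finset.sum_congr rfl fun p _ => ?_
  by_cases h : p 0 = v
  · subst h
    rw [if_pos hv, if_pos rfl]
  · have := stdSimplex_add_le_one q.2 h
    rw [if_neg (by linarith), if_neg h, zero_div]

variable {T}

/-- The values of the potential at the two edges of the face `f` that meet at the vertex `p 0`
jump by the same amount across `f`. -/
theorem potential_glue {x : QuadSpace n} {θ : Fin n × Equiv.Perm (Fin 4) → ℝ}
    (h1 : ∀ s, θ (T.step s) = θ s + T.arcJump x s) (h2 : ∀ s, θ (flip s) = θ s)
    {i : Fin n} {f : Fin 4} {p : Equiv.Perm (Fin 4)} (h0 : p 0 ≠ f) (h1' : p 1 ≠ f) :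
    θ (T.adj i f, T.perm i f * p) = θ (i, p) + (x (i, quadType (p 0) f) -
      x (T.adj i f, quadType (T.perm i f (p 0)) (T.perm i f f))) := by
  have key (p : Equiv.Perm (Fin 4)) : θ (T.adj i (p 2), T.perm i (p 2) * p) = θ (i, p) +
      (x (i, quadType (p 0) (p 2)) -
      x (T.adj i (p 2), quadType (T.perm i (p 2) (p 0)) (T.perm i (p 2) (p 2)))) := by
    have := h1 (i, p)
    rw [← h2] at this
    rw [arcJump, step_zero, step_three, step_fst] at this
    rw [← this]
    congr 1
    simp [flip, step, mul_assoc]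
  have hf : p 2 = f ∨ p 3 = f := by
    obtain ⟨k, rfl⟩ := p.surjective f
    fin_cases k
    · exact absurd rfl h0
    · exact absurd rfl h1'
    · exact Or.inl rfl
    · exact Or.inr rfl
  rcases hf with rfl | rfl
  · exact key p
  · have h := key (p * Equiv.swap 2 3)
    have h02 : Equiv.swap (2 : Fin 4) 3 0 = 0 := by decide
    simp only [Equiv.Perm.mul_apply, Equiv.swap_apply_left, h02] at h
    rw [show θ (i, p * Equiv.swap 2 3) = θ (i, p) from h2 (i, p), ← mul_assoc] at h
    rw [← h]
    exact (h2 (T.adj i (p 3), T.perm i (p 3) * p)).symm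

/-- Since the weights of the interpolation add up to `1`, it jumps across a face by the same
constant as the potential. -/
theorem interpolation_glue {x : QuadSpace n} {θ : Fin n × Equiv.Perm (Fin 4) → ℝ}
    (h1 : ∀ s, θ (T.step s) = θ s + T.arcJump x s) (h2 : ∀ s, θ (flip s) = θ s)
    {i : Fin n} {f v : Fin 4} {y y' : stdSimplex ℝ (Fin 4)} (hf : y f = 0)
    (hy' : ∀ u, y' (T.perm i f u) = y u) (hv : 1 / 2 < y v) (hv1 : y v ≠ 1) :
    interpolation θ (T.adj i f, y') = interpolation θ (i, y) + (x (i, quadType v f) -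
      x (T.adj i f, quadType (T.perm i f v) (T.perm i f f))) := by
  have hvf : v ≠ f := by rintro rfl; rw [hf] at hv; norm_num at hv
  set a := x (i, quadType v f) - x (T.adj i f, quadType (T.perm i f v) (T.perm i f f)) with ha
  rw [interpolation_eq θ (q := (i, y)) hv,
    interpolation_eq θ (q := (T.adj i f, y')) (v := T.perm i f v) (by simpa [hy'] using hv)]
  simp only [hy']
  have hne : 2 * (1 - y v) ≠ 0 := by
    intro h; apply hv1; linarith
  rw [div_eq_iff hne, add_mul, div_mul_cancel₀ _ hne]
  have h3 := sum_perm_eq_sum_compl v (fun w => y w)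
  rw [show ∑ w, y w = 1 from y.2.2] at h3
  rw [← h3, Finset.mul_sum, ← Finset.sum_add_distrib,
    ← Equiv.sum_comp (Equiv.mulLeft (T.perm i f))]
  refine Finset.sum_congr rfl fun p _ => ?_
  simp only [Equiv.coe_mulLeft, Equiv.Perm.mul_apply, (T.perm i f).injective.eq_iff, hy']
  by_cases hp : p 0 = v
  · simp only [hp, if_true]
    by_cases hp1 : p 1 = f
    · simp [hp1, hf]
    · rw [potential_glue h1 h2 (hp ▸ hvf) hp1, hp, ← ha]
      ring
  · simp [hp]

theorem continuousAt_interpolation (θ : Fin n × Equiv.Perm (Fin 4) → ℝ)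
    {q : Fin n × stdSimplex ℝ (Fin 4)} {v : Fin 4} (hv : 1 / 2 < q.2 v) (hv1 : q.2 v ≠ 1) :
    ContinuousAt (interpolation θ) q := by
  have hc (v : Fin 4) : Continuous fun q : Fin n × stdSimplex ℝ (Fin 4) => q.2 v :=
    (continuous_coord v).comp continuous_snd
  have hθ (p : Equiv.Perm (Fin 4)) :
      Continuous fun q : Fin n × stdSimplex ℝ (Fin 4) => θ (q.1, p) :=
    (continuous_of_discreteTopology (f := fun i => θ (i, p))).comp continuous_fst
  have h : ContinuousAt (fun q : Fin n × stdSimplex ℝ (Fin 4) =>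
      (∑ p : Equiv.Perm (Fin 4), if p 0 = v then q.2 (p 1) * θ (q.1, p) else 0) /
        (2 * (1 - q.2 v))) q := by
    refine ContinuousAt.div ?_ (by have := hc v; fun_prop) fun h => hv1 (by linarith)
    refine (continuous_finsetSum _ fun p _ => ?_).continuousAt
    split_ifs
    · exact (hc _).mul (hθ p)
    · exact continuous_const
  refine h.congr ?_
  filter_upwards [(isOpen_lt continuous_const (hc v)).mem_nhds hv] with q' hq'
  exact (interpolation_eq θ hq').symm

/-- An integral solution of the quadrilateral matching equations defines a 1-cocycle on the link
of each vertex.  Realised as a circle-valued map on a punctured neighbourhood of the vertex, it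
lifts to `ℝ` there, and the lift shows that the cocycle is a coboundary. -/
theorem exists_int_triangle_coords_at (hT : IsClosedThreeManifold T.Space)
    {z : Fin n × Fin 3 → ℤ} (hz : T.MatchingEquations fun k => (z k : ℝ))
    (p₀ : Fin n × stdSimplex ℝ (Fin 4)) (hp₀ : ∃ v, p₀.2 v = 1) :
    ∃ b : Fin n → Fin 4 → ℤ, ∀ i v f, v ≠ f →
      (∀ x : stdSimplex ℝ (Fin 4), x v = 1 → T.toSpace (i, x) = T.toSpace p₀) →
      b (T.adj i f) (T.perm i f v) + (z (i, quadType v f) -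
        z (T.adj i f, quadType (T.perm i f v) (T.perm i f f))) = b i v := by
  obtain ⟨θ, h1, h2⟩ := hz.exists_potential
  obtain ⟨V, hVo, hV, H, hHc, hHl, hHg⟩ := exists_local_lift hT
    (AddCircle.isCoveringMap_coe (1 : ℝ)) QuotientAddGroup.mk_surjective
    (Pn := fun y => ∃ v, 1 / 2 < y v) (Ps := fun y => ∃ v, y v = 1)
    (fun σ y ⟨v, hv⟩ => ⟨σ.symm v, by simpa using hv⟩)
    (fun σ y ⟨v, hv⟩ => ⟨σ.symm v, by simpa using hv⟩) isOpen_vertexNhd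
    (by
      have : {x : stdSimplex ℝ (Fin 4) | ∃ v, x v = 1} =
          ⋃ v, {x : stdSimplex ℝ (Fin 4) | x v = 1} := by ext; simp
      rw [this]
      exact Set.finite_iUnion fun v => Set.Subsingleton.finite fun x hx y hy =>
        stdSimplex_eq_of_eq_one hx hy)
    (G := fun q => (interpolation θ q : AddCircle (1 : ℝ)))
    (by
      rintro ⟨i, y⟩ ⟨j, y'⟩ ⟨f, hf, hj, hy'⟩
      dsimp only at hf hj hy'
      subst hj
      by_cases hv : ∃ v, 1 / 2 < y v
      · obtain ⟨v, hv⟩ := hv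
        by_cases hv1 : y v = 1
        · rw [interpolation_eq θ (q := (i, y)) hv, interpolation_eq θ (q := (T.adj i f, y'))
            (v := T.perm i f v) (by simpa [hy'] using hv)]
          simp [hy', hv1]
        · rw [interpolation_glue h1 h2 hf hy' hv hv1, AddCircle.coe_add, eq_comm, add_eq_left,
            AddCircle.coe_eq_zero_iff]
          exact ⟨z (i, quadType v f) - z (T.adj i f, quadType (T.perm i f v) (T.perm i f f)),
            by simp⟩
      · have hv' : ¬ ∃ v, 1 / 2 < y' v := fun ⟨v, h⟩ => hv ⟨(T.perm i f).symm v, by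
          rw [← hy']; simpa using h⟩
        push Not at hv hv'
        have h0 : interpolation θ (i, y) = 0 :=
          Finset.sum_eq_zero fun p _ => if_neg (hv (p 0)).not_gt
        have h0' : interpolation θ (T.adj i f, y') = 0 :=
          Finset.sum_eq_zero fun p _ => if_neg (hv' (p 0)).not_gt
        rw [h0, h0'])
    (by
      rintro ⟨i, y⟩ ⟨⟨v, hv⟩, hs⟩
      refine ContinuousAt.continuousWithinAt ?_
      exact (AddCircle.continuous_mk' (1 : ℝ)).continuousAt.comp
        (continuousAt_interpolation θ hv fun h => hs ⟨v, h⟩))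
    (p₀ := p₀) (by obtain ⟨v, hv⟩ := hp₀; exact ⟨v, by rw [hv]; norm_num⟩) hp₀
  -- on each corner at the vertex, the lift is the interpolation plus an integer
  have germ (i : Fin n) (v : Fin 4) : ∃ b : ℤ,
      (∀ x : stdSimplex ℝ (Fin 4), x v = 1 → T.toSpace (i, x) = T.toSpace p₀) →
      ∃ ε > (0 : ℝ), ∀ x : stdSimplex ℝ (Fin 4), 1 - ε < x v → x v < 1 →
        H (i, x) = interpolation θ (i, x) + b := by
    by_cases hiv : ∀ x : stdSimplex ℝ (Fin 4), x v = 1 → T.toSpace (i, x) = T.toSpace p₀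
    swap
    · exact ⟨0, fun h => absurd h hiv⟩
    obtain ⟨w, hw⟩ : ∃ w : Fin 4, v ≠ w := ⟨v + 1, ne_add_one v⟩
    set x₀ := edgePoint hw (le_refl (0 : ℝ)) zero_le_one
    have hx₀ : x₀ v = 1 := by simp [x₀, edgePoint_apply]
    have hmem : (i, x₀) ∈ V := hV _ (hiv x₀ hx₀)
    obtain ⟨r, hr, hball⟩ := Metric.isOpen_iff.1 (hVo.preimage
      (by fun_prop : Continuous fun x : stdSimplex ℝ (Fin 4) => (i, x))) x₀ hmem
    set ε := min r (1 / 2) with hε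
    have hε0 : 0 < ε := lt_min hr (by norm_num)
    have hεr : ε ≤ r := min_le_left _ _
    have hε2 : ε ≤ 1 / 2 := min_le_right _ _
    have hVx (x : stdSimplex ℝ (Fin 4)) (hx : 1 - ε < x v) : (i, x) ∈ V := by
      apply hball
      rw [Metric.mem_ball, Subtype.dist_eq, dist_pi_lt_iff hr]
      intro u
      rw [Real.dist_eq, abs_lt]
      have hxu : 0 ≤ x u := x.2.1 u
      have hxv : 0 ≤ x v := x.2.1 v
      by_cases hu : u = v
      · subst hu
        have h3 : x u ≤ 1 := by
          have := stdSimplex_add_le_one x hw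
          have h4 : 0 ≤ x w := x.2.1 w
          linarith
        change -r < x u - x₀ u ∧ x u - x₀ u < r
        rw [hx₀]
        constructor <;> linarith
      · have h3 := stdSimplex_add_le_one x hu
        have h4 : x₀ u = 0 := by simp [x₀, edgePoint_apply, hu]
        change -r < x u - x₀ u ∧ x u - x₀ u < r
        rw [h4]
        constructor <;> linarith
    have hns (x : stdSimplex ℝ (Fin 4)) (h3 : 1 - ε < x v) (h4 : x v < 1) : ¬ ∃ u, x u = 1 := by
      rintro ⟨u, hu⟩
      by_cases huv : u = v
      · subst huv; linarith
      · have := stdSimplex_add_le_one x huv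
        linarith
    set C : Set (stdSimplex ℝ (Fin 4)) := {x | 1 - ε < x v ∧ x v < 1} with hC
    have hCp : IsPreconnected C := by
      refine isPreconnected_stdSimplex_of_convex (K := {y | 1 - ε < y v} ∩ {y | y v < 1}) ?_
      have hl : IsLinearMap ℝ fun y : Fin 4 → ℝ => y v :=
        (LinearMap.proj (R := ℝ) (φ := fun _ : Fin 4 => ℝ) v).isLinear
      exact (convex_halfSpace_gt hl _).inter (convex_halfSpace_lt hl _)
    set x₁ := edgePoint hw (δ := ε / 2) (by linarith) (by linarith)
    have hx₁ : x₁ ∈ C := by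
      simp only [hC, mem_ofPred_eq, x₁, edgePoint_apply, if_true]
      constructor <;> linarith
    have hcoe (x : stdSimplex ℝ (Fin 4)) (hx : x ∈ C) :
        ((H (i, x) : ℝ) : AddCircle (1 : ℝ)) = (interpolation θ (i, x) : ℝ) :=
      hHl _ (hVx x hx.1) (hns x hx.1 hx.2)
    obtain ⟨b, hb⟩ : ∃ b : ℤ, H (i, x₁) = interpolation θ (i, x₁) + b := by
      have := hcoe x₁ hx₁
      rw [← sub_eq_zero, ← AddCircle.coe_sub, AddCircle.coe_eq_zero_iff] at this
      obtain ⟨b, hb⟩ := this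
      refine ⟨b, ?_⟩
      simp only [zsmul_eq_mul, mul_one] at hb
      linarith
    -- both sides lift the same map on the connected set `C`, and they agree at `x₁`
    refine ⟨b, fun _ => ⟨ε, hε0, fun x h3 h4 => ?_⟩⟩
    refine (AddCircle.isCoveringMap_coe (1 : ℝ)).eqOn_of_comp_eqOn hCp
      (g₁ := fun x => H (i, x)) (g₂ := fun x => interpolation θ (i, x) + b) ?_ ?_ ?_ hx₁ hb ⟨h3, h4⟩
    · exact hHc.comp (by fun_prop : Continuous fun x : stdSimplex ℝ (Fin 4) => (i, x)).continuousOn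
        fun x hx => ⟨hVx x hx.1, hns x hx.1 hx.2⟩
    · intro x hx
      refine ContinuousAt.continuousWithinAt (ContinuousAt.add ?_ continuousAt_const)
      refine (continuousAt_interpolation θ (q := (i, x)) (v := v) ?_ hx.2.ne).comp
        (by fun_prop : Continuous fun x : stdSimplex ℝ (Fin 4) => (i, x)).continuousAt
      have := hx.1
      change 1 / 2 < x v
      linarith
    · intro x hx
      simp only [Function.comp_apply, AddCircle.coe_add, hcoe x hx]
      rw [left_eq_add, AddCircle.coe_eq_zero_iff]
      exact ⟨b, by simp⟩
  choose b hb using germ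
  -- compare the integers of two adjacent corners at a point of the face between them
  refine ⟨b, fun i v f hvf hiv => ?_⟩
  obtain ⟨w, hwv, hwf⟩ : ∃ w : Fin 4, v ≠ w ∧ w ≠ f := exists_third v f
  have hiv' (x : stdSimplex ℝ (Fin 4)) (hx : x (T.perm i f v) = 1) :
      T.toSpace (T.adj i f, x) = T.toSpace p₀ := by
    set x₀ := edgePoint hwv (le_refl (0 : ℝ)) zero_le_one
    have h3 : x₀ f = 0 := by simp [x₀, edgePoint_apply, hvf.symm]
    have h4 : x = relabel (T.perm i f) x₀ := stdSimplex_eq_of_eq_one hx (by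
      simp [x₀, edgePoint_apply])
    rw [h4, ← hiv x₀ (by simp [x₀, edgePoint_apply])]
    exact (Quot.sound (glued_relabel h3)).symm
  obtain ⟨ε, hε, h⟩ := hb i v hiv
  obtain ⟨ε', hε', h'⟩ := hb _ _ hiv'
  set δ := min (min ε ε') (1 / 2) / 2 with hδ
  have hδ0 : 0 < δ := by positivity
  have hδ1 : δ < ε := by
    have : min (min ε ε') (1 / 2) ≤ ε := (min_le_left _ _).trans (min_le_left _ _)
    linarith
  have hδ2 : δ < ε' := by
    have : min (min ε ε') (1 / 2) ≤ ε' := (min_le_left _ _).trans (min_le_right _ _)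
    linarith
  have hδ3 : δ ≤ 1 / 4 := by
    have : min (min ε ε') (1 / 2) ≤ 1 / 2 := min_le_right _ _
    linarith
  set x := edgePoint hwv hδ0.le (by linarith)
  have hxv : x v = 1 - δ := by simp [x, edgePoint_apply]
  have hxf : x f = 0 := by simp [x, edgePoint_apply, hvf.symm, hwf.symm]
  have e1 := h x (by linarith) (by linarith)
  have e2 := h' (relabel (T.perm i f) x) (by rw [relabel_apply]; linarith)
    (by rw [relabel_apply]; linarith)
  have e3 := hHg _ _ (glued_relabel (T := T) (i := i) hxf)
  have e4 := interpolation_glue h1 h2 (i := i) hxf (relabel_apply _ x) (v := v) (by linarith)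
    (by linarith)
  have e5 : ((b (T.adj i f) (T.perm i f v) + (z (i, quadType v f) -
      z (T.adj i f, quadType (T.perm i f v) (T.perm i f f))) : ℤ) : ℝ) = b i v := by
    push_cast
    linarith
  exact_mod_cast e5

/-- Integral solutions of the quadrilateral matching equations extend to triangle coordinates. -/
theorem exists_int_triangle_coords (hT : IsClosedThreeManifold T.Space)
    {z : Fin n × Fin 3 → ℤ} (hz : T.MatchingEquations fun k => (z k : ℝ)) :
    ∃ t : Fin n → Fin 4 → ℤ, ∀ i v f, v ≠ f → t i v + z (i, quadType v f) =
      t (T.adj i f) (T.perm i f v) + z (T.adj i f, quadType (T.perm i f v) (T.perm i f f)) := by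
  classical
  have hvert (v : Fin 4) : ∃ x : stdSimplex ℝ (Fin 4), x v = 1 :=
    ⟨edgePoint (ne_add_one v) (le_refl (0 : ℝ)) zero_le_one, by
      simp [edgePoint_apply]⟩
  choose e he using hvert
  have key (c : T.Space) : ∃ b : Fin n → Fin 4 → ℤ, ∀ i v f, v ≠ f → T.toSpace (i, e v) = c →
      b (T.adj i f) (T.perm i f v) + (z (i, quadType v f) -
        z (T.adj i f, quadType (T.perm i f v) (T.perm i f f))) = b i v := by
    by_cases hc : ∃ i v, T.toSpace (i, e v) = c
    · obtain ⟨j, w, rfl⟩ := hc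
      obtain ⟨b, hb⟩ := exists_int_triangle_coords_at hT hz (j, e w) ⟨w, he w⟩
      exact ⟨b, fun i v f hvf h => hb i v f hvf fun x hx => by
        rw [stdSimplex_eq_of_eq_one hx (he v), h]⟩
    · exact ⟨0, fun i v f _ h => absurd ⟨i, v, h⟩ hc⟩
  choose b hb using key
  -- the triangle coordinates of a corner come from the lift near its own vertex
  refine ⟨fun i v => -b (T.toSpace (i, e v)) i v, fun i v f hvf => ?_⟩
  have h1 := hb _ i v f hvf rfl
  have h2 : T.toSpace (T.adj i f, e (T.perm i f v)) = T.toSpace (i, e v) := by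
    have h3 : e v f = 0 := by
      have := stdSimplex_add_le_one (e v) hvf
      have h0 : 0 ≤ e v f := (e v).2.1 f
      rw [he] at this
      linarith
    rw [stdSimplex_eq_of_eq_one (he (T.perm i f v))
      (show relabel (T.perm i f) (e v) (T.perm i f v) = 1 by rw [relabel_apply, he])]
    exact (Quot.sound (glued_relabel h3)).symm
  simp only [h2]
  linarith

end FaceGluing

/-! ### No edge is identified with its reverse -/

/-- The non-zero vectors of `W` up to sign. -/
def signSetoid (W : Type*) [AddCommGroup W] : Setoid {w : W // w ≠ 0} where
  r a b := (a : W) = b ∨ (a : W) = -b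
  iseqv := ⟨fun _ => Or.inl rfl, fun h => by
    rcases h with h | h
    · exact Or.inl h.symm
    · exact Or.inr (by rw [h, neg_neg]), fun h h' => by
    rcases h with h | h <;> rcases h' with h' | h' <;> simp [h, h']⟩

/-- The group of signs acts freely, and the ball around `e` of radius `‖e‖` is disjoint from its
negative. -/
theorem isCoveringMap_signSetoid (W : Type*) [NormedAddCommGroup W] [NormedSpace ℝ W] :
    IsCoveringMap (Quotient.mk (signSetoid W)) := by
  let _ : MulAction ℤˣ {w : W // w ≠ 0} :=
    { smul := fun g w => ⟨(g : ℤ) • (w : W), by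
        rcases Int.units_eq_one_or g with rfl | rfl <;> simp [w.2]⟩
      one_smul := fun w => Subtype.ext (by
        change ((1 : ℤˣ) : ℤ) • (w : W) = w
        simp)
      mul_smul := fun g h w => Subtype.ext (by
        change ((g * h : ℤˣ) : ℤ) • (w : W) = (g : ℤ) • (h : ℤ) • (w : W)
        rw [Units.val_mul, mul_smul]) }
  have hsmul (g : ℤˣ) (w : {w : W // w ≠ 0}) : ((g • w : {w : W // w ≠ 0}) : W) =
    (g : ℤ) • (w : W) := rfl
  suffices h : IsQuotientCoveringMap (Quotient.mk (signSetoid W)) ℤˣ from h.isCoveringMap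
  have hq : Topology.IsQuotientMap (Quotient.mk (signSetoid W)) := isQuotientMap_quotient_mk'
  refine { hq with
    continuous_const_smul := fun g => ?_
    apply_eq_iff_mem_orbit := fun {a b} => ?_
    disjoint := fun e => ?_ }
  · refine Continuous.subtype_mk (f := fun w : {w : W // w ≠ 0} => (g : ℤ) • (w : W)) ?_ _
    fun_prop
  · rw [Quotient.eq]
    constructor
    · rintro (h | h)
      · exact ⟨1, Subtype.ext (by rw [hsmul, h]; simp)⟩
      · exact ⟨-1, Subtype.ext (by rw [hsmul, h]; simp)⟩
    · rintro ⟨g, rfl⟩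
      rcases Int.units_eq_one_or g with rfl | rfl
      · exact Or.inl (by simp)
      · exact Or.inr (by simp [hsmul])
  · refine ⟨Metric.ball e ‖(e : W)‖, Metric.ball_mem_nhds _ (norm_pos_iff.2 e.2), ?_⟩
    rintro g ⟨_, ⟨a, ha, rfl⟩, hb⟩
    rcases Int.units_eq_one_or g with rfl | rfl
    · rfl
    · exfalso
      rw [Metric.mem_ball, Subtype.dist_eq, dist_eq_norm] at ha hb
      simp only [hsmul, Units.val_neg, Units.val_one, neg_smul, one_smul] at hb
      have h1 : ‖(a : W) - e + (-a - e)‖ = 2 * ‖(e : W)‖ := by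
        rw [show (a : W) - e + (-a - e) = (-2 : ℝ) • (e : W) by module, norm_smul]
        norm_num
      have h2 := norm_add_le ((a : W) - e) (-a - e)
      linarith

open Classical in
/-- A vector as a non-zero vector; zero is sent to an arbitrary non-zero vector. -/
noncomputable def toNonzero {W : Type*} [AddCommGroup W] [Nontrivial W] (w : W) :
    {w : W // w ≠ 0} :=
  if h : w ≠ 0 then ⟨w, h⟩ else ⟨_, (exists_ne (0 : W)).choose_spec⟩

theorem coe_toNonzero {W : Type*} [AddCommGroup W] [Nontrivial W] {w : W} (h : w ≠ 0) :
    (toNonzero w : W) = w := by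
  rw [toNonzero, dif_pos h]

theorem continuousAt_toNonzero {W : Type*} [NormedAddCommGroup W] [Nontrivial W] {w : W}
    (h : w ≠ 0) : ContinuousAt (toNonzero : W → {w : W // w ≠ 0}) w := by
  have hi : IsInducing (Subtype.val : {w : W // w ≠ 0} → W) := ⟨rfl⟩
  rw [hi.continuousAt_iff]
  refine continuousAt_id.congr ?_
  filter_upwards [isOpen_compl_singleton.mem_nhds h] with w' hw'
  exact (coe_toNonzero hw').symm

theorem mk_toNonzero_neg {W : Type*} [AddCommGroup W] [Nontrivial W] (w : W) :
    (Quotient.mk (signSetoid W) (toNonzero (-w))) = Quotient.mk (signSetoid W) (toNonzero w) := by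
  by_cases h : w = 0
  · rw [h, neg_zero]
  · exact Quotient.sound (Or.inr (by rw [coe_toNonzero h, coe_toNonzero (neg_ne_zero.2 h)]))

theorem stdSimplex_sum_perm (x : stdSimplex ℝ (Fin 4)) (p : Equiv.Perm (Fin 4)) :
    x (p 0) + x (p 1) + x (p 2) + x (p 3) = 1 := by
  have h := x.2.2
  rw [← Equiv.sum_comp p, Fin.sum_univ_four] at h
  exact h

theorem stdSimplex_nonneg (x : stdSimplex ℝ (Fin 4)) (v : Fin 4) : 0 ≤ x v := x.2.1 v

theorem perm_eq_of_edge_eq : ∀ p p' : Equiv.Perm (Fin 4),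
    (p' 0 = p 0 ∨ p' 0 = p 1) → (p' 1 = p 0 ∨ p' 1 = p 1) →
      p' = p ∨ p' = p * Equiv.swap 2 3 ∨ p' = p * Equiv.swap 0 1 ∨
        p' = p * Equiv.swap 0 1 * Equiv.swap 2 3 := by
  decide

/-- At most two coordinates exceed `1 / 3`. -/
theorem eq_or_eq_of_third_lt {x : stdSimplex ℝ (Fin 4)} {p : Equiv.Perm (Fin 4)}
    (h0 : 1 / 3 < x (p 0)) (h1 : 1 / 3 < x (p 1)) {v : Fin 4} (hv : 1 / 3 < x v) :
    v = p 0 ∨ v = p 1 := by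
  have hs := stdSimplex_sum_perm x p
  have h2 := stdSimplex_nonneg x (p 2)
  have h3 := stdSimplex_nonneg x (p 3)
  obtain ⟨k, rfl⟩ := p.surjective v
  fin_cases k
  · exact Or.inl rfl
  · exact Or.inr rfl
  · exfalso
    change 1 / 3 < x (p 2) at hv
    linarith
  · exfalso
    change 1 / 3 < x (p 3) at hv
    linarith

/-- The point with coordinates `(1 - δ) / 2` at `p 0` and `p 1`, and `δ` at `p 3`. -/
noncomputable def facePoint (p : Equiv.Perm (Fin 4)) {δ : ℝ} (h0 : 0 ≤ δ) (h1 : δ ≤ 1) :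
    stdSimplex ℝ (Fin 4) :=
  relabel p ⟨![(1 - δ) / 2, (1 - δ) / 2, 0, δ], fun v => by
    fin_cases v <;> simp <;> linarith, by simp [Fin.sum_univ_four]⟩

section

variable (p : Equiv.Perm (Fin 4)) {δ : ℝ} (h0 : 0 ≤ δ) (h1 : δ ≤ 1)

theorem facePoint_zero : facePoint p h0 h1 (p 0) = (1 - δ) / 2 := relabel_apply p _ 0
theorem facePoint_one : facePoint p h0 h1 (p 1) = (1 - δ) / 2 := relabel_apply p _ 1
theorem facePoint_two : facePoint p h0 h1 (p 2) = 0 := relabel_apply p _ 2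
theorem facePoint_three : facePoint p h0 h1 (p 3) = δ := relabel_apply p _ 3

end

theorem stdSimplex_eq_midpoint {x y : stdSimplex ℝ (Fin 4)} {p : Equiv.Perm (Fin 4)}
    (hx0 : x (p 0) = 1 / 2) (hx1 : x (p 1) = 1 / 2) (hy0 : y (p 0) = 1 / 2)
    (hy1 : y (p 1) = 1 / 2) : x = y := by
  have hx := stdSimplex_sum_perm x p
  have hx2 := stdSimplex_nonneg x (p 2)
  have hx3 := stdSimplex_nonneg x (p 3)
  have hy := stdSimplex_sum_perm y p
  have hy2 := stdSimplex_nonneg y (p 2)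
  have hy3 := stdSimplex_nonneg y (p 3)
  apply Subtype.ext
  funext v
  change x v = y v
  obtain ⟨k, rfl⟩ := p.surjective v
  fin_cases k
  · change x (p 0) = y (p 0)
    linarith
  · change x (p 1) = y (p 1)
    linarith
  · change x (p 2) = y (p 2)
    linarith
  · change x (p 3) = y (p 3)
    linarith

namespace FaceGluing

variable {n : ℕ} (T : FaceGluing n)

/-- The state on the far side of the face through which a walk has entered, looking back. -/
def back (s : Fin n × Equiv.Perm (Fin 4)) : Fin n × Equiv.Perm (Fin 4) := T.step (flip s)

theorem back_back (s : Fin n × Equiv.Perm (Fin 4)) : T.back (T.back s) = s := by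
  rw [back, back, step_flip_step, flip_flip]

theorem back_rev (s : Fin n × Equiv.Perm (Fin 4)) : T.back (rev s) = rev (T.back s) := by
  rw [back, back, flip_rev, step_rev]

theorem back_flip (s : Fin n × Equiv.Perm (Fin 4)) : T.back (flip s) = T.step s := by
  rw [back, flip_flip]

/-- No face is glued to itself. -/
theorem back_ne_rev (s : Fin n × Equiv.Perm (Fin 4)) : T.back s ≠ rev s := by
  intro h
  refine T.partner_ne s.1 (s.2 3) ?_
  have h1 := congr_arg Prod.fst h
  have h2 := congr_arg (fun s => s.2 3) h
  simp only [back, step_fst, step_three, flip_two, flip_fst, rev_fst, rev_three] at h1 h2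
  rw [h1, h2]

/-- The model space, up to sign, for a neighbourhood of the midpoint of an edge. -/
abbrev EdgeModel (n : ℕ) : Type :=
  ℝ × (Fin n × Equiv.Perm (Fin 4) → ℝ) × (Fin n × Equiv.Perm (Fin 4) → ℝ)

/-- A vector attached to a face and an edge of it, which changes sign with the direction of the
edge. -/
noncomputable def faceVector (s : Fin n × Equiv.Perm (Fin 4)) : Fin n × Equiv.Perm (Fin 4) → ℝ :=
  Pi.single s 1 + Pi.single (T.back s) 1 - Pi.single (rev s) 1 - Pi.single (rev (T.back s)) 1

/-- A vector attached to a tetrahedron and an edge of it, which changes sign with the direction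
of the edge. -/
noncomputable def tetVector (s : Fin n × Equiv.Perm (Fin 4)) : Fin n × Equiv.Perm (Fin 4) → ℝ :=
  Pi.single s 1 + Pi.single (flip s) 1 - Pi.single (rev s) 1 - Pi.single (rev (flip s)) 1

theorem faceVector_rev (s : Fin n × Equiv.Perm (Fin 4)) :
    T.faceVector (rev s) = - T.faceVector s := by
  simp only [faceVector, back_rev, rev_rev]
  abel

theorem faceVector_back (s : Fin n × Equiv.Perm (Fin 4)) :
    T.faceVector (T.back s) = T.faceVector s := by
  simp only [faceVector, back_back]
  abel

theorem tetVector_rev (s : Fin n × Equiv.Perm (Fin 4)) :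
    tetVector (rev s) = - tetVector s := by
  simp only [tetVector, flip_rev, rev_rev]
  abel

theorem tetVector_flip (s : Fin n × Equiv.Perm (Fin 4)) : tetVector (flip s) = tetVector s := by
  simp only [tetVector, flip_flip]
  abel

theorem faceVector_ne_zero (s : Fin n × Equiv.Perm (Fin 4)) : T.faceVector s ≠ 0 := by
  intro h
  have h1 := congr_fun h s
  have h2 : s ≠ rev (T.back s) := fun h => T.back_ne_rev s (by
    rw [← rev_rev (T.back s), ← h])
  simp only [faceVector, Pi.sub_apply, Pi.add_apply, Pi.single_eq_same,
    Pi.single_eq_of_ne (rev_ne s).symm, Pi.single_eq_of_ne h2, Pi.zero_apply, sub_zero] at h1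
  have h3 : 0 ≤ (Pi.single (T.back s) 1 : Fin n × Equiv.Perm (Fin 4) → ℝ) s := by
    rw [Pi.single_apply]; split_ifs <;> norm_num
  linarith

theorem tetVector_ne_zero (s : Fin n × Equiv.Perm (Fin 4)) : tetVector s ≠ 0 := by
  intro h
  have h1 := congr_fun h s
  have h2 : s ≠ rev (flip s) := fun h => rev_ne_flip s (by
    rw [← rev_rev (flip s), ← h])
  simp only [tetVector, Pi.sub_apply, Pi.add_apply, Pi.single_eq_same,
    Pi.single_eq_of_ne (rev_ne s).symm, Pi.single_eq_of_ne h2, Pi.zero_apply, sub_zero] at h1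
  have h3 : 0 ≤ (Pi.single (flip s) 1 : Fin n × Equiv.Perm (Fin 4) → ℝ) s := by
    rw [Pi.single_apply]; split_ifs <;> norm_num
  linarith

/-- A map from a neighbourhood of the midpoint of the edge of a state to the model space.  It
vanishes only at the midpoint, it is compatible with the face gluings, and it changes sign when
the edge is reversed. -/
noncomputable def edgeMap (s : Fin n × Equiv.Perm (Fin 4)) (x : stdSimplex ℝ (Fin 4)) :
    EdgeModel n :=
  (x (s.2 0) - x (s.2 1), x (s.2 2) • T.faceVector s + x (s.2 3) • T.faceVector (T.step s),
    (x (s.2 2) * x (s.2 3)) • tetVector s)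

theorem edgeMap_rev (s : Fin n × Equiv.Perm (Fin 4)) (x : stdSimplex ℝ (Fin 4)) :
    T.edgeMap (rev s) x = - T.edgeMap s x := by
  simp only [edgeMap, rev_zero, rev_one, rev_two, rev_three, step_rev, faceVector_rev,
    tetVector_rev, smul_neg, Prod.neg_mk, neg_sub, neg_add]

theorem edgeMap_flip (s : Fin n × Equiv.Perm (Fin 4)) (x : stdSimplex ℝ (Fin 4)) :
    T.edgeMap (flip s) x = T.edgeMap s x := by
  have h1 : T.faceVector (flip s) = T.faceVector (T.step s) := by
    rw [← faceVector_back, back_flip]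
  have h2 : T.faceVector (T.step (flip s)) = T.faceVector s := T.faceVector_back s
  simp only [edgeMap, flip_zero, flip_one, flip_two, flip_three, tetVector_flip, h1, h2, mul_comm]
  rw [add_comm]

theorem edgeMap_step {s : Fin n × Equiv.Perm (Fin 4)} {x y : stdSimplex ℝ (Fin 4)}
    (hx : x (s.2 2) = 0) (hy : ∀ v, y (T.perm s.1 (s.2 2) v) = x v) :
    T.edgeMap (T.step s) y = T.edgeMap s x := by
  simp [edgeMap, step_zero, step_one, step_two, step_three, hy, hx]

theorem edgeMap_ne_zero {s : Fin n × Equiv.Perm (Fin 4)} {x : stdSimplex ℝ (Fin 4)}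
    (h : ¬ ∃ v w, v ≠ w ∧ x v = 1 / 2 ∧ x w = 1 / 2) : T.edgeMap s x ≠ 0 := by
  intro h0
  simp only [edgeMap, Prod.mk_eq_zero] at h0
  obtain ⟨h1, h2, h3⟩ := h0
  have hz : x (s.2 2) = 0 ∧ x (s.2 3) = 0 := by
    rcases smul_eq_zero.1 h3 with h3 | h3
    · rcases mul_eq_zero.1 h3 with h3 | h3
      · rw [h3, zero_smul, zero_add] at h2
        exact ⟨h3, (smul_eq_zero.1 h2).resolve_right (T.faceVector_ne_zero _)⟩
      · rw [h3, zero_smul, add_zero] at h2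
        exact ⟨(smul_eq_zero.1 h2).resolve_right (T.faceVector_ne_zero _), h3⟩
    · exact absurd h3 (tetVector_ne_zero s)
  have hs := stdSimplex_sum_perm x s.2
  rw [hz.1, hz.2] at hs
  exact h ⟨s.2 0, s.2 1, by simp, by linarith, by linarith⟩

theorem edgeMap_facePoint_ne_zero (s : Fin n × Equiv.Perm (Fin 4)) {δ : ℝ} (h0 : 0 < δ)
    (h1 : δ ≤ 1) : T.edgeMap s (facePoint s.2 h0.le h1) ≠ 0 := by
  intro h
  have h3 := congr_arg (fun w => w.2.1) h
  simp only [edgeMap, facePoint_two, facePoint_three, zero_smul, zero_add] at h3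
  rcases smul_eq_zero.1 h3 with h3 | h3
  · exact h0.ne' h3
  · exact T.faceVector_ne_zero _ h3

theorem continuous_edgeMap (p : Equiv.Perm (Fin 4)) :
    Continuous fun q : Fin n × stdSimplex ℝ (Fin 4) => T.edgeMap (q.1, p) q.2 := by
  have hc (v : Fin 4) : Continuous fun q : Fin n × stdSimplex ℝ (Fin 4) => q.2 v :=
    (continuous_coord v).comp continuous_snd
  have hd {A : Type} [TopologicalSpace A] (θ : Fin n → A) :
      Continuous fun q : Fin n × stdSimplex ℝ (Fin 4) => θ q.1 :=
    (continuous_of_discreteTopology (f := θ)).comp continuous_fst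
  exact ((hc (p 0)).sub (hc (p 1))).prodMk
    ((((hc (p 2)).smul (hd fun i => T.faceVector (i, p))).add
      ((hc (p 3)).smul (hd fun i => T.faceVector (T.step (i, p))))).prodMk
    (((hc (p 2)).mul (hc (p 3))).smul (hd fun i => tetVector (i, p))))

open Classical in
/-- The map to the model space up to sign, near the midpoints of all edges; away from these the
value is irrelevant. -/
noncomputable def edgeClass (q : Fin n × stdSimplex ℝ (Fin 4)) :
    Quotient (signSetoid (EdgeModel n)) :=
  Quotient.mk _ (toNonzero (if h : ∃ p : Equiv.Perm (Fin 4), 1 / 3 < q.2 (p 0) ∧ 1 / 3 < q.2 (p 1)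
    then T.edgeMap (q.1, h.choose) q.2 else 0))

/-- The permutations that fit a point differ by the symmetries of the edge, under which the edge
map is invariant up to sign. -/
theorem edgeClass_eq {q : Fin n × stdSimplex ℝ (Fin 4)} {p : Equiv.Perm (Fin 4)}
    (h0 : 1 / 3 < q.2 (p 0)) (h1 : 1 / 3 < q.2 (p 1)) :
    T.edgeClass q = Quotient.mk _ (toNonzero (T.edgeMap (q.1, p) q.2)) := by
  have h : ∃ p : Equiv.Perm (Fin 4), 1 / 3 < q.2 (p 0) ∧ 1 / 3 < q.2 (p 1) := ⟨p, h0, h1⟩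
  rw [edgeClass, dif_pos h]
  obtain ⟨h0', h1'⟩ := h.choose_spec
  rcases perm_eq_of_edge_eq p h.choose (eq_or_eq_of_third_lt h0 h1 h0')
    (eq_or_eq_of_third_lt h0 h1 h1') with e | e | e | e
  · rw [e]
  · rw [e, show (q.1, p * Equiv.swap 2 3) = flip (q.1, p) from rfl, edgeMap_flip]
  · rw [e, show (q.1, p * Equiv.swap 0 1) = rev (q.1, p) from rfl, edgeMap_rev, mk_toNonzero_neg]
  · rw [e, show (q.1, p * Equiv.swap 0 1 * Equiv.swap 2 3) = flip (rev (q.1, p)) from rfl,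
      edgeMap_flip, edgeMap_rev, mk_toNonzero_neg]

theorem edgeClass_glue {q q' : Fin n × stdSimplex ℝ (Fin 4)} (h : T.Glued q q') :
    T.edgeClass q = T.edgeClass q' := by
  obtain ⟨i, y⟩ := q
  obtain ⟨j, y'⟩ := q'
  obtain ⟨f, hf, hj, hy⟩ := h
  dsimp only at hf hj hy
  subst hj
  by_cases hp : ∃ p : Equiv.Perm (Fin 4), 1 / 3 < y (p 0) ∧ 1 / 3 < y (p 1)
  · obtain ⟨p, h0, h1, rfl⟩ : ∃ p : Equiv.Perm (Fin 4), 1 / 3 < y (p 0) ∧ 1 / 3 < y (p 1) ∧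
        p 2 = f := by
      obtain ⟨p, h0, h1⟩ := hp
      obtain ⟨k, rfl⟩ := p.surjective f
      have h02 : Equiv.swap (2 : Fin 4) 3 0 = 0 := by decide
      have h12 : Equiv.swap (2 : Fin 4) 3 1 = 1 := by decide
      fin_cases k
      · change y (p 0) = 0 at hf
        rw [hf] at h0; norm_num at h0
      · change y (p 1) = 0 at hf
        rw [hf] at h1; norm_num at h1
      · exact ⟨p, h0, h1, rfl⟩
      · refine ⟨p * Equiv.swap 2 3, ?_, ?_, by simp⟩
        · rwa [Equiv.Perm.mul_apply, h02]
        · rwa [Equiv.Perm.mul_apply, h12]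
    rw [T.edgeClass_eq (q := (i, y)) h0 h1, T.edgeClass_eq (q := (T.adj i (p 2), y'))
      (p := (T.step (i, p)).2) (by rw [step_zero, hy]; exact h0) (by rw [step_one, hy]; exact h1)]
    rw [show (((T.adj i (p 2), y') : Fin n × stdSimplex ℝ (Fin 4)).1, (T.step (i, p)).2) =
      T.step (i, p) from rfl, T.edgeMap_step (s := (i, p)) hf hy]
  · have hp' : ¬ ∃ p : Equiv.Perm (Fin 4), 1 / 3 < y' (p 0) ∧ 1 / 3 < y' (p 1) := by
      rintro ⟨p, h0, h1⟩
      refine hp ⟨(T.perm i f).symm * p, ?_, ?_⟩ <;>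
        rwa [← hy, Equiv.Perm.mul_apply, Equiv.apply_symm_apply]
    rw [edgeClass, edgeClass, dif_neg hp, dif_neg hp']

theorem isOpen_edgeNhd :
    IsOpen {y : Fin 4 → ℝ | ∃ p : Equiv.Perm (Fin 4), 1 / 3 < y (p 0) ∧ 1 / 3 < y (p 1)} := by
  have : {y : Fin 4 → ℝ | ∃ p : Equiv.Perm (Fin 4), 1 / 3 < y (p 0) ∧ 1 / 3 < y (p 1)} =
      ⋃ p : Equiv.Perm (Fin 4), {y : Fin 4 → ℝ | 1 / 3 < y (p 0)} ∩ {y | 1 / 3 < y (p 1)} := by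
    ext; simp
  rw [this]
  exact isOpen_iUnion fun p => (isOpen_lt continuous_const (continuous_apply _)).inter
    (isOpen_lt continuous_const (continuous_apply _))

theorem finite_midpoints :
    {x : stdSimplex ℝ (Fin 4) | ∃ v w, v ≠ w ∧ x v = 1 / 2 ∧ x w = 1 / 2}.Finite := by
  have : {x : stdSimplex ℝ (Fin 4) | ∃ v w, v ≠ w ∧ x v = 1 / 2 ∧ x w = 1 / 2} ⊆
      ⋃ p : Equiv.Perm (Fin 4), {x | x (p 0) = 1 / 2 ∧ x (p 1) = 1 / 2} := by
    rintro x ⟨v, w, hvw, hv, hw⟩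
    have : ∀ v w : Fin 4, v ≠ w → ∃ p : Equiv.Perm (Fin 4), p 0 = v ∧ p 1 = w := by decide
    obtain ⟨p, rfl, rfl⟩ := this v w hvw
    exact mem_iUnion.2 ⟨p, hv, hw⟩
  refine Set.Finite.subset (Set.finite_iUnion fun p => Set.Subsingleton.finite ?_) this
  exact fun x hx y hy => stdSimplex_eq_midpoint hx.1 hx.2 hy.1 hy.2

variable {T}

/-- If walking once around an edge reversed it, a neighbourhood of its midpoint would be a cone on
a projective plane; but the resulting double covering of the punctured neighbourhood is trivial
near a point of a manifold. -/
theorem not_sameCycle_rev (hT : IsClosedThreeManifold T.Space) (s₀ : Fin n × Equiv.Perm (Fin 4)) :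
    ¬ T.step.SameCycle s₀ (rev s₀) := by
  intro hs₀
  obtain ⟨d, -, hd⟩ := hs₀.exists_pow_eq'
  let mid (s : Fin n × Equiv.Perm (Fin 4)) : Fin n × stdSimplex ℝ (Fin 4) :=
    (s.1, facePoint s.2 (le_refl (0 : ℝ)) zero_le_one)
  have hmid0 (s : Fin n × Equiv.Perm (Fin 4)) : (mid s).2 (s.2 0) = 1 / 2 := by
    simp only [mid]; rw [facePoint_zero]; norm_num
  have hmid1 (s : Fin n × Equiv.Perm (Fin 4)) : (mid s).2 (s.2 1) = 1 / 2 := by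
    simp only [mid]; rw [facePoint_one]; norm_num
  obtain ⟨V, hVo, hV, H, hHc, hHl, hHg⟩ := exists_local_lift hT
    (isCoveringMap_signSetoid (EdgeModel n)) Quotient.mk_surjective
    (Pn := fun y => ∃ p : Equiv.Perm (Fin 4), 1 / 3 < y (p 0) ∧ 1 / 3 < y (p 1))
    (Ps := fun y => ∃ v w, v ≠ w ∧ y v = 1 / 2 ∧ y w = 1 / 2)
    (fun σ y ⟨p, h0, h1⟩ => ⟨σ⁻¹ * p, by simpa using h0, by simpa using h1⟩)
    (fun σ y ⟨v, w, hvw, h0, h1⟩ => ⟨σ.symm v, σ.symm w, by simpa using hvw, by simpa using h0,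
      by simpa using h1⟩) isOpen_edgeNhd finite_midpoints
    (G := T.edgeClass) (fun _ _ => T.edgeClass_glue)
    (by
      rintro ⟨i, y⟩ ⟨⟨p, h0, h1⟩, hs⟩
      refine ContinuousAt.continuousWithinAt ?_
      have hc (v : Fin 4) : Continuous fun q : Fin n × stdSimplex ℝ (Fin 4) => q.2 v :=
        (continuous_coord v).comp continuous_snd
      have h : ContinuousAt (fun q : Fin n × stdSimplex ℝ (Fin 4) =>
          Quotient.mk (signSetoid (EdgeModel n)) (toNonzero (T.edgeMap (q.1, p) q.2))) (i, y) :=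
        continuous_quotient_mk'.continuousAt.comp
          (ContinuousAt.comp (g := toNonzero) (continuousAt_toNonzero (T.edgeMap_ne_zero hs))
            (T.continuous_edgeMap p).continuousAt)
      refine h.congr ?_
      filter_upwards [(isOpen_lt continuous_const (hc (p 0))).mem_nhds h0,
        (isOpen_lt continuous_const (hc (p 1))).mem_nhds h1] with q h0 h1
      exact (T.edgeClass_eq h0 h1).symm)
    (p₀ := mid s₀) ⟨s₀.2, by rw [hmid0]; norm_num, by rw [hmid1]; norm_num⟩
    ⟨s₀.2 0, s₀.2 1, by simp, hmid0 s₀, hmid1 s₀⟩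
  -- `P s` says that the lift agrees with the map of the state `s` near the midpoint of its edge
  let P (s : Fin n × Equiv.Perm (Fin 4)) : Prop := ∃ ε > (0 : ℝ), ∀ x : stdSimplex ℝ (Fin 4),
    1 / 2 - ε < x (s.2 0) → 1 / 2 - ε < x (s.2 1) → x (s.2 0) + x (s.2 1) < 1 →
      H (s.1, x) = toNonzero (T.edgeMap s x)
  -- near the midpoint and off the edge, the lift is a vector that is determined up to sign
  have hPr (s) (hs : T.toSpace (mid s) = T.toSpace (mid s₀)) : P s ∨ P (rev s) := by
    have hmem := hV _ hs
    obtain ⟨r, hr, hball⟩ := Metric.isOpen_iff.1 (hVo.preimage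
      (by fun_prop : Continuous fun x : stdSimplex ℝ (Fin 4) => (s.1, x))) (mid s).2 hmem
    set ε := min (r / 2) (1 / 6) with hε
    have hε0 : 0 < ε := lt_min (by linarith) (by norm_num)
    have hεr : ε ≤ r / 2 := min_le_left _ _
    have hε6 : ε ≤ 1 / 6 := min_le_right _ _
    set C : Set (stdSimplex ℝ (Fin 4)) := {x | (1 / 2 - ε < x (s.2 0) ∧ 1 / 2 - ε < x (s.2 1)) ∧
      x (s.2 0) + x (s.2 1) < 1} with hC
    have hCp : IsPreconnected C := by
      have hl (v : Fin 4) : IsLinearMap ℝ fun y : Fin 4 → ℝ => y v :=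
        (LinearMap.proj (R := ℝ) (φ := fun _ : Fin 4 => ℝ) v).isLinear
      have hl2 : IsLinearMap ℝ fun y : Fin 4 → ℝ => y (s.2 0) + y (s.2 1) :=
        (LinearMap.proj (R := ℝ) (φ := fun _ : Fin 4 => ℝ) (s.2 0) +
          LinearMap.proj (R := ℝ) (φ := fun _ : Fin 4 => ℝ) (s.2 1)).isLinear
      exact isPreconnected_stdSimplex_of_convex (K := ({y | 1 / 2 - ε < y (s.2 0)} ∩
        {y | 1 / 2 - ε < y (s.2 1)}) ∩ {y | y (s.2 0) + y (s.2 1) < 1})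
        (((convex_halfSpace_gt (hl _) _).inter (convex_halfSpace_gt (hl _) _)).inter
          (convex_halfSpace_lt hl2 _))
    have hCV (x) (hx : x ∈ C) : (s.1, x) ∈ V := by
      apply hball
      rw [Metric.mem_ball, Subtype.dist_eq, dist_pi_lt_iff hr]
      intro u
      change |x u - (mid s).2 u| < r
      obtain ⟨⟨h0, h1⟩, h2⟩ := hx
      have hx := stdSimplex_sum_perm x s.2
      have hx2 := stdSimplex_nonneg x (s.2 2)
      have hx3 := stdSimplex_nonneg x (s.2 3)
      have hm2 : (mid s).2 (s.2 2) = 0 := facePoint_two _ le_rfl zero_le_one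
      have hm3 : (mid s).2 (s.2 3) = 0 := facePoint_three _ le_rfl zero_le_one
      obtain ⟨k, rfl⟩ := s.2.surjective u
      rw [abs_lt]
      fin_cases k
      · change -r < x (s.2 0) - (mid s).2 (s.2 0) ∧ x (s.2 0) - (mid s).2 (s.2 0) < r
        rw [hmid0]
        constructor <;> linarith
      · change -r < x (s.2 1) - (mid s).2 (s.2 1) ∧ x (s.2 1) - (mid s).2 (s.2 1) < r
        rw [hmid1]
        constructor <;> linarith
      · change -r < x (s.2 2) - (mid s).2 (s.2 2) ∧ x (s.2 2) - (mid s).2 (s.2 2) < r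
        rw [hm2]
        constructor <;> linarith
      · change -r < x (s.2 3) - (mid s).2 (s.2 3) ∧ x (s.2 3) - (mid s).2 (s.2 3) < r
        rw [hm3]
        constructor <;> linarith
    have hthird (x) (hx : x ∈ C) : 1 / 3 < x (s.2 0) ∧ 1 / 3 < x (s.2 1) :=
      ⟨by linarith [hx.1.1], by linarith [hx.1.2]⟩
    have hCs (x) (hx : x ∈ C) : ¬ ∃ v w, v ≠ w ∧ x v = 1 / 2 ∧ x w = 1 / 2 := by
      rintro ⟨v, w, hvw, hv, hw⟩
      obtain ⟨h0, h1⟩ := hthird x hx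
      have h2 := hx.2
      rcases eq_or_eq_of_third_lt h0 h1 (v := v) (by rw [hv]; norm_num) with rfl | rfl <;>
        rcases eq_or_eq_of_third_lt h0 h1 (v := w) (by rw [hw]; norm_num) with rfl | rfl
      · exact hvw rfl
      · linarith
      · linarith
      · exact hvw rfl
    have hHC (x) (hx : x ∈ C) : Quotient.mk _ (H (s.1, x)) =
        Quotient.mk (signSetoid (EdgeModel n)) (toNonzero (T.edgeMap s x)) := by
      rw [hHl _ (hCV x hx) (hCs x hx), T.edgeClass_eq (hthird x hx).1 (hthird x hx).2]
    have hHcC : ContinuousOn (fun x => H (s.1, x)) C :=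
      hHc.comp (by fun_prop : Continuous fun x : stdSimplex ℝ (Fin 4) => (s.1, x)).continuousOn
        fun x hx => ⟨hCV x hx, hCs x hx⟩
    have hcont (s' : Fin n × Equiv.Perm (Fin 4)) :
        ContinuousOn (fun x => toNonzero (T.edgeMap s' x)) C := fun x hx =>
      (ContinuousAt.comp (g := toNonzero) (continuousAt_toNonzero (T.edgeMap_ne_zero (hCs x hx)))
        ((T.continuous_edgeMap s'.2).comp (by fun_prop :
          Continuous fun x : stdSimplex ℝ (Fin 4) => (s'.1, x))).continuousAt).continuousWithinAt
    set x₁ := facePoint s.2 (δ := ε / 2) (by linarith) (by linarith) with hx₁'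
    have hx₁ : x₁ ∈ C := by
      simp only [hC, mem_ofPred_eq, hx₁', facePoint_zero, facePoint_one]
      refine ⟨⟨?_, ?_⟩, ?_⟩ <;> linarith
    rcases Quotient.exact (hHC x₁ hx₁) with h | h
    · refine Or.inl ⟨ε, hε0, fun x h0 h1 h2 => ?_⟩
      exact (isCoveringMap_signSetoid _).eqOn_of_comp_eqOn hCp hHcC (hcont s) hHC hx₁
        (Subtype.ext h) ⟨⟨h0, h1⟩, h2⟩
    · refine Or.inr ⟨ε, hε0, fun x h0 h1 h2 => ?_⟩
      rw [rev_zero] at h0 h2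
      rw [rev_one] at h1 h2
      refine (isCoveringMap_signSetoid _).eqOn_of_comp_eqOn hCp hHcC (hcont (rev s))
        (fun x hx => ?_) hx₁ (Subtype.ext ?_) ⟨⟨h1, h0⟩, by linarith⟩
      · simp only [Function.comp_apply, edgeMap_rev, mk_toNonzero_neg]
        exact hHC x hx
      · have hne := T.edgeMap_ne_zero (s := s) (hCs x₁ hx₁)
        simp only [edgeMap_rev]
        rw [h, coe_toNonzero hne, coe_toNonzero (neg_ne_zero.2 hne)]
  -- the maps of a state and of its reverse are opposite and not zero
  have hPs (s) (h : P s) : ¬ P (rev s) := by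
    rintro ⟨ε', hε', h'⟩
    obtain ⟨ε, hε, h⟩ := h
    set δ := min (min ε ε') (1 / 2) with hδ
    have hδ0 : 0 < δ := by positivity
    have hδ1 : δ ≤ ε := (min_le_left _ _).trans (min_le_left _ _)
    have hδ2 : δ ≤ ε' := (min_le_left _ _).trans (min_le_right _ _)
    have hδ3 : δ ≤ 1 / 2 := min_le_right _ _
    set x := facePoint s.2 hδ0.le (by linarith) with hx
    have hx0 : x (s.2 0) = (1 - δ) / 2 := facePoint_zero _ _ _
    have hx1 : x (s.2 1) = (1 - δ) / 2 := facePoint_one _ _ _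
    have hx3 : x (s.2 3) = δ := facePoint_three _ _ _
    have hx2 : x (s.2 2) = 0 := facePoint_two _ _ _
    have e1 := h x (by linarith) (by linarith) (by linarith)
    have e2 := h' x (by rw [rev_zero]; linarith) (by rw [rev_one]; linarith)
      (by rw [rev_zero, rev_one]; linarith)
    have hne : T.edgeMap s x ≠ 0 := T.edgeMap_facePoint_ne_zero s hδ0 _
    rw [rev_fst, e1, edgeMap_rev] at e2
    have e3 := congr_arg Subtype.val e2
    rw [coe_toNonzero hne, coe_toNonzero (neg_ne_zero.2 hne)] at e3
    exact hne (self_eq_neg.1 e3)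
  have hmidstep (s : Fin n × Equiv.Perm (Fin 4)) :
      T.toSpace (mid (T.step s)) = T.toSpace (mid s) := by
    have h1 : (mid s).2 (s.2 2) = 0 := facePoint_two _ le_rfl zero_le_one
    have h2 : mid (T.step s) = (T.adj s.1 (s.2 2), relabel (T.perm s.1 (s.2 2)) (mid s).2) := by
      refine Prod.ext rfl (stdSimplex_eq_midpoint (hmid0 _) (hmid1 _) ?_ ?_)
      · rw [step_zero, relabel_apply, hmid0]
      · rw [step_one, relabel_apply, hmid1]
    rw [h2]
    exact (Quot.sound (glued_relabel h1)).symm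
  -- compare the lifts in two adjacent tetrahedra at a point of the face between them
  have hPstep (s) (hs : T.toSpace (mid s) = T.toSpace (mid s₀)) (h : P s) : P (T.step s) := by
    refine (hPr (T.step s) ((hmidstep s).trans hs)).resolve_right ?_
    rintro ⟨ε', hε', h'⟩
    obtain ⟨ε, hε, h⟩ := h
    set δ := min (min ε ε') (1 / 2) with hδ
    have hδ0 : 0 < δ := by positivity
    have hδ1 : δ ≤ ε := (min_le_left _ _).trans (min_le_left _ _)
    have hδ2 : δ ≤ ε' := (min_le_left _ _).trans (min_le_right _ _)
    have hδ3 : δ ≤ 1 / 2 := min_le_right _ _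
    set x := facePoint s.2 hδ0.le (by linarith) with hx
    have hx0 : x (s.2 0) = (1 - δ) / 2 := facePoint_zero _ _ _
    have hx1 : x (s.2 1) = (1 - δ) / 2 := facePoint_one _ _ _
    have hx3 : x (s.2 3) = δ := facePoint_three _ _ _
    have hx2 : x (s.2 2) = 0 := facePoint_two _ _ _
    have e1 := h x (by linarith) (by linarith) (by linarith)
    have e2 := h' (relabel (T.perm s.1 (s.2 2)) x)
      (by rw [rev_zero, step_one, relabel_apply]; linarith)
      (by rw [rev_one, step_zero, relabel_apply]; linarith)
      (by rw [rev_zero, rev_one, step_zero, step_one, relabel_apply, relabel_apply]; linarith)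
    have e3 := hHg _ _ (glued_relabel (T := T) (i := s.1) hx2)
    have hne : T.edgeMap s x ≠ 0 := T.edgeMap_facePoint_ne_zero s hδ0 _
    rw [rev_fst, step_fst, ← e3, e1, edgeMap_rev,
      T.edgeMap_step hx2 (relabel_apply _ x)] at e2
    have e4 := congr_arg Subtype.val e2
    rw [coe_toNonzero hne, coe_toNonzero (neg_ne_zero.2 hne)] at e4
    exact hne (self_eq_neg.1 e4)
  have hpow (s) (hs : T.toSpace (mid s) = T.toSpace (mid s₀)) (h : P s) (k : ℕ) :
      T.toSpace (mid ((T.step ^ k) s)) = T.toSpace (mid s₀) ∧ P ((T.step ^ k) s) := by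
    induction k with
    | zero => exact ⟨hs, h⟩
    | succ k ih =>
      rw [pow_succ', Equiv.Perm.mul_apply]
      exact ⟨(hmidstep _).trans ih.1, hPstep _ ih.1 ih.2⟩
  rcases hPr s₀ rfl with h | h
  · exact hPs s₀ h (hd ▸ (hpow s₀ rfl h d).2)
  · have hrevpow (k : ℕ) : (T.step ^ k) (rev s₀) = rev ((T.step ^ k) s₀) := by
      induction k with
      | zero => rfl
      | succ k ih => rw [pow_succ', Equiv.Perm.mul_apply, ih, step_rev, Equiv.Perm.mul_apply]
    have hm : mid (rev s₀) = mid s₀ := Prod.ext rfl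
      (stdSimplex_eq_midpoint (p := s₀.2) (by rw [← rev_one]; exact hmid1 _)
        (by rw [← rev_zero]; exact hmid0 _) (hmid0 _) (hmid1 _))
    have := (hpow (rev s₀) (by rw [hm]) h d).2
    rw [hrevpow, hd, rev_rev] at this
    exact hPs s₀ this h

end FaceGluing

/-! ### The dimension of the solution space of the matching equations -/

namespace FaceGluing

variable {n : ℕ} (T : FaceGluing n)

/-- The real solutions of the quadrilateral matching equations. -/
def quadSolutions : Submodule ℝ (QuadSpace n) where
  carrier := {x | T.MatchingEquations x}
  zero_mem' := fun s => by simp [slope]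
  add_mem' := fun {x y} hx hy s => by
    have : ∀ s', slope (x + y) s' = slope x s' + slope y s' := fun s' => by
      simp only [slope, Pi.add_apply]; ring
    simp only [this, Finset.sum_add_distrib, hx s, hy s, add_zero]
  smul_mem' := fun c x hx s => by
    have : ∀ s', slope (c • x) s' = c * slope x s' := fun s' => by
      simp only [slope, Pi.smul_apply, smul_eq_mul]; ring
    simp only [this, ← Finset.mul_sum, hx s, mul_zero]

theorem mem_quadSolutions {x : QuadSpace n} : x ∈ T.quadSolutions ↔ T.MatchingEquations x := Iff.rfl

/-- The real solutions of the standard matching equations, for triangle and quadrilateral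
coordinates: on both sides of a face, equally many arcs cut off each of its vertices. -/
def standardSolutions : Submodule ℝ ((Fin n × Fin 4 → ℝ) × QuadSpace n) where
  carrier := {y | ∀ i v f, v ≠ f → y.1 (i, v) + y.2 (i, quadType v f) =
    y.1 (T.adj i f, T.perm i f v) + y.2 (T.adj i f, quadType (T.perm i f v) (T.perm i f f))}
  zero_mem' := fun _ _ _ _ => by simp
  add_mem' := fun {y z} hy hz i v f h => by
    have h1 := hy i v f h
    have h2 := hz i v f h
    simp only [Prod.fst_add, Prod.snd_add, Pi.add_apply]
    linarith
  smul_mem' := fun c y hy i v f h => by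
    have h1 := hy i v f h
    simp only [Prod.smul_fst, Prod.smul_snd, Pi.smul_apply, smul_eq_mul]
    rw [← mul_add, h1, mul_add]

variable {T}

/-- A rational solution of the matching equations extends to triangle coordinates: clear
denominators. -/
theorem rat_mem_map_standardSolutions (hT : IsClosedThreeManifold T.Space)
    {y : Fin n × Fin 3 → ℚ} (hy : T.MatchingEquations fun k => (y k : ℝ)) :
    (fun k => (y k : ℝ)) ∈ T.standardSolutions.map (LinearMap.snd ℝ _ _) := by
  set N : ℕ := ∏ k, (y k).den with hN
  have hN0 : (N : ℝ) ≠ 0 := by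
    rw [Nat.cast_ne_zero, hN]
    exact Finset.prod_ne_zero_iff.2 fun k _ => (y k).den_nz
  have hz (k) : ∃ z : ℤ, (z : ℝ) = N * y k := by
    obtain ⟨m, hm⟩ : (y k).den ∣ N := Finset.dvd_prod_of_mem _ (Finset.mem_univ k)
    refine ⟨m * (y k).num, ?_⟩
    have : (((y k).den * y k : ℚ) : ℝ) = ((y k).num : ℚ) := by rw [Rat.den_mul_eq_num]
    push_cast at this ⊢
    rw [hm]
    push_cast
    rw [← this]
    ring
  choose z hz using hz
  have hzs : T.MatchingEquations fun k => (z k : ℝ) := by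
    have := T.quadSolutions.smul_mem (N : ℝ) (T.mem_quadSolutions.2 hy)
    have hzN : (fun k => (z k : ℝ)) = (N : ℝ) • fun k => (y k : ℝ) := by
      funext k
      simp [hz]
    rw [hzN]
    exact this
  obtain ⟨t, ht⟩ := exists_int_triangle_coords hT hzs
  have hmem : (fun k => (z k : ℝ)) ∈ T.standardSolutions.map (LinearMap.snd ℝ _ _) := by
    refine ⟨(fun c => (t c.1 c.2 : ℝ), fun k => (z k : ℝ)), fun i v f h => ?_, rfl⟩
    dsimp only
    exact_mod_cast ht i v f h
  convert Submodule.smul_mem _ (N : ℝ)⁻¹ hmem using 1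
  funext k
  simp [hz, hN0]

/-- Every real solution of the quadrilateral matching equations extends to triangle coordinates:
the equations have rational coefficients, so it is a real combination of rational solutions. -/
theorem quadSolutions_le_map_standardSolutions (hT : IsClosedThreeManifold T.Space) :
    T.quadSolutions ≤ T.standardSolutions.map (LinearMap.snd ℝ _ _) := by
  classical
  intro x hx
  let B := Module.Basis.ofVectorSpace ℚ ℝ
  set I := Finset.univ.biUnion fun k => (B.repr (x k)).support with hI
  have hxI : x = ∑ b ∈ I, B b • fun k => ((B.repr (x k) b : ℚ) : ℝ) := by
    funext k
    rw [Finset.sum_apply]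
    conv_lhs => rw [← B.linearCombination_repr (x k), Finsupp.linearCombination_apply]
    rw [Finsupp.sum_of_support_subset (s := I) _
      (Finset.subset_biUnion_of_mem (fun k => (B.repr (x k)).support) (Finset.mem_univ k)) _
      (by simp)]
    refine Finset.sum_congr rfl fun b _ => ?_
    simp [Rat.smul_def, mul_comm]
  rw [hxI]
  refine Submodule.sum_mem _ fun b _ => Submodule.smul_mem _ _ (rat_mem_map_standardSolutions hT ?_)
  intro s
  have h := congr_arg (fun r => ((B.repr r b : ℚ) : ℝ)) (hx s)
  simpa [slope] using h

end FaceGluing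

/-- A fixed-point-free involution of a finite set has a set of representatives, containing half of
the elements. -/
theorem Function.Involutive.exists_half {X : Type*} [Fintype X] {ι : X → X}
    (hι : Function.Involutive ι) (hne : ∀ x, ι x ≠ x) :
    ∃ R : Finset X, 2 * R.card = Fintype.card X ∧ (∀ x, x ∉ R ↔ ι x ∈ R) := by
  classical
  let e := Fintype.equivFin X
  set R := Finset.univ.filter fun x => e x < e (ι x) with hR
  have hmem (x : X) : x ∉ R ↔ ι x ∈ R := by
    simp only [hR, Finset.mem_filter, Finset.mem_univ, true_and, hι x, not_lt]
    exact ⟨fun h => h.lt_of_ne fun h => hne x (e.injective h), le_of_lt⟩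
  refine ⟨R, ?_, hmem⟩
  have h1 : Rᶜ.card = R.card := by
    refine Finset.card_bij' (fun x _ => ι x) (fun x _ => ι x) (fun x hx => ?_) (fun x hx => ?_)
      (fun x _ => hι x) fun x _ => hι x
    · exact (hmem x).1 (Finset.mem_compl.1 hx)
    · rw [Finset.mem_compl, hmem, hι x]
      exact hx
  rw [← Finset.card_add_card_compl R, h1, two_mul]

/-- Subspaces of `K^R` that are orthogonal for the dot product have total dimension at most
`#R`. -/
theorem finrank_range_add_finrank_range_le {K X Y R : Type*} [Field K] [Fintype X] [Fintype Y]
    [Fintype R] (f : (X → K) →ₗ[K] (R → K)) (g : (Y → K) →ₗ[K] (R → K))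
    (h : ∀ x y, f x ⬝ᵥ g y = 0) :
    Module.finrank K (LinearMap.range f) + Module.finrank K (LinearMap.range g) ≤
      Fintype.card R := by
  classical
  set M := LinearMap.toMatrix' f with hM
  have hf : f = M.mulVecLin := (Matrix.toLin'_toMatrix' f).symm
  have hle : LinearMap.range g ≤ LinearMap.ker M.transpose.mulVecLin := by
    rintro _ ⟨y, rfl⟩
    rw [LinearMap.mem_ker, Matrix.mulVecLin_apply]
    apply dotProduct_eq_zero
    intro x
    rw [dotProduct_comm, Matrix.dotProduct_mulVec, Matrix.vecMul_transpose]
    have := h x y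
    rwa [hf] at this
  have h1 := Submodule.finrank_mono hle
  have h2 := M.transpose.mulVecLin.finrank_range_add_finrank_ker
  have h3 : Module.finrank K (LinearMap.range M.transpose.mulVecLin) =
      Module.finrank K (LinearMap.range f) := by
    rw [hf]
    exact M.rank_transpose
  rw [Module.finrank_fintype_fun_eq_card] at h2
  omega

/-! ### Counting vertices, edges and vertices of links -/

theorem perm_eq_of_zero_eq : ∀ p p' : Equiv.Perm (Fin 4), p 0 = p' 0 →
    p' = p ∨ p' = p * Equiv.swap 2 3 ∨ p' = p * Equiv.swap 1 3 ∨
      p' = p * Equiv.swap 2 3 * Equiv.swap 1 3 ∨ p' = p * Equiv.swap 1 3 * Equiv.swap 2 3 ∨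
      p' = p * Equiv.swap 2 3 * Equiv.swap 1 3 * Equiv.swap 2 3 := by
  decide

theorem filter_perm_eq : ∀ p : Equiv.Perm (Fin 4),
    (Finset.univ.filter fun p' : Equiv.Perm (Fin 4) => p' 0 = p 0 ∧ p' 2 = p 2) =
      {p, p * Equiv.swap 1 3} := by
  decide

theorem exists_perm_of_ne : ∀ v f : Fin 4, v ≠ f → ∃ p : Equiv.Perm (Fin 4), p 0 = v ∧ p 2 = f := by
  decide

theorem exists_perm_zero : ∀ v : Fin 4, ∃ p : Equiv.Perm (Fin 4), p 0 = v := by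
  decide

theorem card_distinct_pairs :
    Fintype.card {d : Fin 4 × Fin 4 // d.1 ≠ d.2} = 12 := by
  decide

theorem sum_perm_eq_zero_of_swap {g : Equiv.Perm (Fin 4) → ZMod 2}
    (hg : ∀ p, g (p * Equiv.swap 2 3) = g p) (v : Fin 4) :
    ∑ p : Equiv.Perm (Fin 4) with p 0 = v, g p = 0 := by
  have h02 : Equiv.swap (2 : Fin 4) 3 0 = 0 := by decide
  refine Finset.sum_involution (fun p _ => p * Equiv.swap 2 3) (fun p _ => ?_) (fun p _ _ h => ?_)
    (fun p hp => ?_) fun p _ => ?_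
  · rw [hg]
    exact CharTwo.add_self_eq_zero _
  · have := congr_arg (fun q : Equiv.Perm (Fin 4) => q 2) h
    simp at this
  · simpa [h02] using hp
  · simp [mul_assoc]

namespace FaceGluing

variable {n : ℕ} (T : FaceGluing n)

/-- The vertices of the triangulation: classes of vertices of tetrahedra. -/
abbrev Vertex : Type :=
  Quot fun c c' : Fin n × Fin 4 => ∃ f, c.2 ≠ f ∧ c' = (T.adj c.1 f, T.perm c.1 f c.2)

noncomputable instance : Fintype T.Vertex := Fintype.ofFinite _

theorem step_pow_flip (k : ℕ) (s : Fin n × Equiv.Perm (Fin 4)) :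
    (T.step ^ k) (flip ((T.step ^ k) s)) = flip s := by
  induction k with
  | zero => rfl
  | succ k ih =>
    have h1 (a) : (T.step ^ (k + 1)) a = T.step ((T.step ^ k) a) := by rw [pow_succ']; rfl
    have h2 (a) : (T.step ^ (k + 1)) a = (T.step ^ k) (T.step a) := by rw [pow_succ]; rfl
    rw [h1 s, h2, step_flip_step, ih]

theorem step_pow_rev (k : ℕ) (s : Fin n × Equiv.Perm (Fin 4)) :
    (T.step ^ k) (rev s) = rev ((T.step ^ k) s) := by
  induction k with
  | zero => rfl
  | succ k ih => rw [pow_succ', Equiv.Perm.mul_apply, ih, step_rev, Equiv.Perm.mul_apply]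

variable {T}

theorem sameCycle_flip {s s' : Fin n × Equiv.Perm (Fin 4)} (h : T.step.SameCycle s s') :
    T.step.SameCycle (flip s) (flip s') := by
  obtain ⟨k, -, rfl⟩ := h.exists_pow_eq'
  exact Equiv.Perm.SameCycle.symm ⟨k, by rw [zpow_natCast, step_pow_flip]⟩

variable (T) in
/-- Two states are equivalent if they belong to the same edge, directed in the same way. -/
def directedEdgeSetoid : Setoid (Fin n × Equiv.Perm (Fin 4)) where
  r s s' := T.step.SameCycle s s' ∨ T.step.SameCycle s (flip s')
  iseqv := by
    refine ⟨fun s => Or.inl (Equiv.Perm.SameCycle.refl _ _), fun {s s'} h => ?_,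
      fun {a b c} h h' => ?_⟩
    · rcases h with h | h
      · exact Or.inl h.symm
      · exact Or.inr (by simpa using (sameCycle_flip h).symm)
    · rcases h with h | h <;> rcases h' with h' | h'
      · exact Or.inl (h.trans h')
      · exact Or.inr (h.trans h')
      · exact Or.inr (h.trans (sameCycle_flip h'))
      · exact Or.inl (by simpa using h.trans (sameCycle_flip h'))

variable (T) in
/-- The directed edges of the triangulation, or equivalently the vertices of the vertex links. -/
abbrev DirectedEdge : Type := Quotient T.directedEdgeSetoid

noncomputable instance : Fintype T.DirectedEdge := Fintype.ofFinite _

variable (T) in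
/-- The directed edge of a state. -/
def directedEdge (s : Fin n × Equiv.Perm (Fin 4)) : T.DirectedEdge := Quotient.mk _ s

theorem directedEdge_step (s : Fin n × Equiv.Perm (Fin 4)) :
    T.directedEdge (T.step s) = T.directedEdge s :=
  Quotient.sound (Or.inl (by
    rw [Equiv.Perm.sameCycle_apply_left]))

theorem directedEdge_flip (s : Fin n × Equiv.Perm (Fin 4)) :
    T.directedEdge (flip s) = T.directedEdge s :=
  Quotient.sound (Or.inr (Equiv.Perm.SameCycle.refl _ _))

/-- Reflecting a walk would fix a tetrahedron or a face half-way, according to the parity of the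
number of steps; the latter is impossible as no face is glued to itself. -/
theorem not_sameCycle_flip_rev (s : Fin n × Equiv.Perm (Fin 4)) :
    ¬ T.step.SameCycle s (flip (rev s)) := by
  intro h
  obtain ⟨k, -, hk⟩ := h.exists_pow_eq'
  obtain ⟨j, hj⟩ := Nat.even_or_odd' k
  set a := (T.step ^ j) s with ha
  have h1 : (T.step ^ j) (flip (rev a)) = flip (rev s) := by
    rw [ha, ← step_pow_rev, step_pow_flip]
  rcases hj with rfl | rfl
  · have h2 : (T.step ^ j) a = (T.step ^ j) (flip (rev a)) := by
      rw [h1, ← hk, ha, ← Equiv.Perm.mul_apply, ← pow_add, two_mul]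
    have h3 := (T.step ^ j).injective h2
    refine rev_ne_flip a ?_
    conv_rhs => rw [h3]
    rw [flip_flip]
  · have h2 : (T.step ^ j) (T.step a) = (T.step ^ j) (flip (rev a)) := by
      rw [h1, ← hk, ha, ← Equiv.Perm.mul_apply, ← Equiv.Perm.mul_apply, ← pow_succ, ← pow_add]
      congr 2
      ring
    have h3 := (T.step ^ j).injective h2
    refine T.back_ne_rev (flip a) ?_
    rw [back_flip, h3, flip_rev]

/-- Reversing a directed edge. -/
def DirectedEdge.rev : T.DirectedEdge → T.DirectedEdge :=
  Quotient.map FaceGluing.rev fun s s' h => by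
    have key {a b : Fin n × Equiv.Perm (Fin 4)} (h : T.step.SameCycle a b) :
        T.step.SameCycle (FaceGluing.rev a) (FaceGluing.rev b) := by
      obtain ⟨k, -, rfl⟩ := h.exists_pow_eq'
      exact ⟨k, by rw [zpow_natCast, step_pow_rev]⟩
    rcases h with h | h
    · exact Or.inl (key h)
    · exact Or.inr (by rw [flip_rev]; exact key h)

theorem DirectedEdge.rev_mk (s : Fin n × Equiv.Perm (Fin 4)) :
    DirectedEdge.rev (T.directedEdge s) = T.directedEdge (FaceGluing.rev s) := rfl

theorem DirectedEdge.rev_involutive : Function.Involutive (DirectedEdge.rev (T := T)) := by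
  rintro ⟨s⟩
  change DirectedEdge.rev (DirectedEdge.rev (T.directedEdge s)) = T.directedEdge s
  rw [rev_mk, rev_mk, rev_rev]

theorem DirectedEdge.rev_ne (hT : IsClosedThreeManifold T.Space) (e : T.DirectedEdge) :
    DirectedEdge.rev e ≠ e := by
  obtain ⟨s⟩ := e
  intro h
  rcases Quotient.exact h.symm with h | h
  · exact not_sameCycle_rev hT s h
  · exact not_sameCycle_flip_rev s h

/-- Gluing along a face that contains an edge preserves the directed edge. -/
theorem directedEdge_glue {i : Fin n} {f : Fin 4} {p : Equiv.Perm (Fin 4)} (hf : p 2 = f) :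
    T.directedEdge (T.adj i f, T.perm i f * p) = T.directedEdge (i, p) := by
  subst hf
  rw [← directedEdge_step (i, p), ← directedEdge_flip (T.step (i, p))]
  congr 1
  simp [step, flip, mul_assoc]

/-- The arcs of the vertex links, seen from one side: the arc `(i, v, f)` cuts off the vertex `v`
from the face `f` of tetrahedron `i`. -/
abbrev Arc (n : ℕ) : Type := Fin n × {d : Fin 4 × Fin 4 // d.1 ≠ d.2}

variable (T) in
/-- The arc on the other side of the face. -/
def arcGlue (d : Arc n) : Arc n :=
  (T.adj d.1 d.2.1.2, ⟨(T.perm d.1 d.2.1.2 d.2.1.1, T.perm d.1 d.2.1.2 d.2.1.2),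
    fun h => d.2.2 ((T.perm d.1 d.2.1.2).injective h)⟩)

theorem arcGlue_involutive : Function.Involutive T.arcGlue := by
  rintro ⟨i, ⟨v, f⟩, h⟩
  simp [arcGlue, T.adj_adj, T.perm_perm]

theorem arcGlue_ne (d : Arc n) : T.arcGlue d ≠ d := by
  obtain ⟨i, ⟨v, f⟩, h⟩ := d
  intro h
  simp only [arcGlue, Prod.mk.injEq, Subtype.mk.injEq] at h
  exact T.partner_ne i f (Prod.ext h.1 h.2.2)

variable (T) in
/-- The sum of a function over the two end points of an arc. -/
def arcSum (c : T.DirectedEdge → ZMod 2) (d : Arc n) : ZMod 2 :=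
  ∑ p : Equiv.Perm (Fin 4) with p 0 = d.2.1.1 ∧ p 2 = d.2.1.2, c (T.directedEdge (d.1, p))

theorem arcSum_glue (c : T.DirectedEdge → ZMod 2) (d : Arc n) :
    T.arcSum c (T.arcGlue d) = T.arcSum c d := by
  symm
  refine Finset.sum_equiv (Equiv.mulLeft (T.perm d.1 d.2.1.2)) (fun p => ?_) fun p hp => ?_
  · rw [Finset.mem_filter, Finset.mem_filter]
    simp [arcGlue]
  · have hf : p 2 = d.2.1.2 := (Finset.mem_filter.1 hp).2.2
    exact congr_arg c (directedEdge_glue hf).symm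

/-- The coboundary of a function on the triangles of the links is orthogonal to the boundary of
a function on their vertices. -/
theorem sum_arcSum_eq_zero (t : Fin n × Fin 4 → ZMod 2) (c : T.DirectedEdge → ZMod 2) :
    ∑ d : Arc n, t (d.1, d.2.1.1) * T.arcSum c d = 0 := by
  rw [Fintype.sum_prod_type]
  refine Finset.sum_eq_zero fun i _ => ?_
  have h1 : ∑ d : {d : Fin 4 × Fin 4 // d.1 ≠ d.2}, t (i, d.1.1) * T.arcSum c (i, d) =
      ∑ d : {d : Fin 4 × Fin 4 // d.1 ≠ d.2},
        ∑ p : Equiv.Perm (Fin 4) with p 0 = d.1.1 ∧ p 2 = d.1.2,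
          t (i, p 0) * c (T.directedEdge (i, p)) := by
    refine Finset.sum_congr rfl fun d _ => ?_
    rw [arcSum, Finset.mul_sum]
    refine Finset.sum_congr rfl fun p hp => ?_
    rw [(Finset.mem_filter.1 hp).2.1]
  have h2 : ∑ d : {d : Fin 4 × Fin 4 // d.1 ≠ d.2},
        ∑ p : Equiv.Perm (Fin 4) with p 0 = d.1.1 ∧ p 2 = d.1.2,
          t (i, p 0) * c (T.directedEdge (i, p)) =
      ∑ p : Equiv.Perm (Fin 4), t (i, p 0) * c (T.directedEdge (i, p)) := by
    simp only [Finset.sum_filter]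
    rw [Finset.sum_comm]
    refine Finset.sum_congr rfl fun p _ => ?_
    rw [Finset.sum_eq_single ⟨(p 0, p 2), by simp⟩]
    · simp
    · rintro ⟨⟨v, f⟩, h⟩ - hne
      refine if_neg fun h => hne ?_
      simp [h.1, h.2]
    · simp
  have h3 : ∑ p : Equiv.Perm (Fin 4), t (i, p 0) * c (T.directedEdge (i, p)) =
      ∑ v, ∑ p : Equiv.Perm (Fin 4) with p 0 = v, t (i, p 0) * c (T.directedEdge (i, p)) :=
    (Finset.sum_fiberwise _ _ _).symm
  rw [h1, h2, h3]
  refine Finset.sum_eq_zero fun v _ => sum_perm_eq_zero_of_swap (fun p => ?_) v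
  have h02 : Equiv.swap (2 : Fin 4) 3 0 = 0 := by decide
  rw [Equiv.Perm.mul_apply, h02, show (i, p * Equiv.swap 2 3) = flip (i, p) from rfl,
    directedEdge_flip]

/-- A closed surface with `k` components has Euler characteristic at most `2 k`, and the links of
the vertices together have `4 n` triangles and `6 n` edges.  With coefficients mod 2, coboundaries
of functions on the triangles and boundaries of functions on the vertices are orthogonal, and both
maps have kernels of dimension at most the number of vertices of the triangulation. -/
theorem card_directedEdge_le :
    Fintype.card T.DirectedEdge ≤ 2 * n + 2 * Fintype.card T.Vertex := by
  classical
  obtain ⟨R, hRc, hR⟩ := (arcGlue_involutive (T := T)).exists_half arcGlue_ne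
  have hcard : R.card = 6 * n := by
    rw [Fintype.card_prod, card_distinct_pairs, Fintype.card_fin] at hRc
    omega
  have hall {Q : Arc n → Prop} (hQ : ∀ d, Q (T.arcGlue d) → Q d) (h : ∀ d ∈ R, Q d) (d) : Q d := by
    by_cases hd : d ∈ R
    · exact h d hd
    · exact hQ d (h _ ((hR d).1 hd))
  let f : (Fin n × Fin 4 → ZMod 2) →ₗ[ZMod 2] (R → ZMod 2) :=
    { toFun := fun t d => t (d.1.1, d.1.2.1.1) + t ((T.arcGlue d).1, (T.arcGlue d).2.1.1)
      map_add' := fun t t' => by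
        funext d; simp only [Pi.add_apply]; ring
      map_smul' := fun a t => by
        funext d; simp only [Pi.smul_apply, smul_eq_mul, RingHom.id_apply]; ring }
  let g : (T.DirectedEdge → ZMod 2) →ₗ[ZMod 2] (R → ZMod 2) :=
    { toFun := fun c d => T.arcSum c d
      map_add' := fun c c' => by
        funext d; simp only [Pi.add_apply, arcSum, Finset.sum_add_distrib]
      map_smul' := fun a c => by
        funext d
        simp only [Pi.smul_apply, smul_eq_mul, RingHom.id_apply, arcSum, Finset.mul_sum] }
  have hfg (t : Fin n × Fin 4 → ZMod 2) (c : T.DirectedEdge → ZMod 2) : f t ⬝ᵥ g c = 0 := by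
    have h1 := sum_arcSum_eq_zero t c
    rw [← Finset.sum_add_sum_compl R] at h1
    have h2 : ∑ d ∈ Rᶜ, t (d.1, d.2.1.1) * T.arcSum c d =
        ∑ d ∈ R, t ((T.arcGlue d).1, (T.arcGlue d).2.1.1) * T.arcSum c d := by
      refine Finset.sum_bij' (fun d _ => T.arcGlue d) (fun d _ => T.arcGlue d)
        (fun d hd => (hR d).1 (Finset.mem_compl.1 hd))
        (fun d hd => by
          rw [Finset.mem_compl, hR, arcGlue_involutive d]; exact hd)
        (fun d _ => arcGlue_involutive d) (fun d _ => arcGlue_involutive d) fun d _ => ?_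
      rw [arcGlue_involutive d, arcSum_glue]
    rw [h2, ← Finset.sum_add_distrib] at h1
    rw [← h1, dotProduct, ← Finset.sum_coe_sort R]
    exact Finset.sum_congr rfl fun d _ => by
      simp only [f, g, LinearMap.coe_mk, AddHom.coe_mk, add_mul]
  -- functions on the triangles that are constant on each link
  have hkf : Module.finrank (ZMod 2) (LinearMap.ker f) ≤ Fintype.card T.Vertex := by
    let m : (T.Vertex → ZMod 2) →ₗ[ZMod 2] (Fin n × Fin 4 → ZMod 2) :=
      LinearMap.funLeft _ _ (Quot.mk _)
    have hle : LinearMap.ker f ≤ LinearMap.range m := by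
      intro t ht
      have h1 : ∀ d : Arc n, t (d.1, d.2.1.1) = t ((T.arcGlue d).1, (T.arcGlue d).2.1.1) := by
        refine hall (fun d h => ?_) fun d hd => ?_
        · rw [h, arcGlue_involutive d]
        · exact CharTwo.add_eq_zero.1 (congr_fun (LinearMap.mem_ker.1 ht) ⟨d, hd⟩)
      refine ⟨Quot.lift t ?_, rfl⟩
      rintro ⟨i, v⟩ _ ⟨f, hf, rfl⟩
      exact h1 (i, ⟨(v, f), hf⟩)
    refine (Submodule.finrank_mono hle).trans (m.finrank_range_le.trans ?_)
    rw [Module.finrank_fintype_fun_eq_card]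
  -- functions on the vertices of the links that are constant on each link
  have hkg : Module.finrank (ZMod 2) (LinearMap.ker g) ≤ Fintype.card T.Vertex := by
    let m : (T.Vertex → ZMod 2) →ₗ[ZMod 2] (Fin n × Equiv.Perm (Fin 4) → ZMod 2) :=
      LinearMap.funLeft _ _ fun s => Quot.mk _ (s.1, s.2 0)
    let e : (T.DirectedEdge → ZMod 2) →ₗ[ZMod 2] (Fin n × Equiv.Perm (Fin 4) → ZMod 2) :=
      LinearMap.funLeft _ _ T.directedEdge
    have he : Function.Injective e :=
      LinearMap.funLeft_injective_of_surjective _ _ _ Quotient.mk_surjective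
    have hle : (LinearMap.ker g).map e ≤ LinearMap.range m := by
      rintro _ ⟨c, hc, rfl⟩
      have h1 : ∀ d : Arc n, T.arcSum c d = 0 := by
        refine hall (fun d h => ?_) fun d hd => ?_
        · rw [← arcSum_glue, h]
        · exact congr_fun (LinearMap.mem_ker.1 hc) ⟨d, hd⟩
      have h13 (i : Fin n) (p : Equiv.Perm (Fin 4)) :
          c (T.directedEdge (i, p * Equiv.swap 1 3)) = c (T.directedEdge (i, p)) := by
        have h2 := h1 (i, ⟨(p 0, p 2), by simp⟩)
        rw [arcSum, filter_perm_eq, Finset.sum_pair] at h2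
        · exact (CharTwo.add_eq_zero.1 h2).symm
        · intro h
          have := congr_arg (fun q : Equiv.Perm (Fin 4) => q 1) h
          simp at this
      have h23 (i : Fin n) (p : Equiv.Perm (Fin 4)) :
          c (T.directedEdge (i, p * Equiv.swap 2 3)) = c (T.directedEdge (i, p)) :=
        congr_arg c (directedEdge_flip (i, p))
      have hall' (i : Fin n) (p p' : Equiv.Perm (Fin 4)) (h : p 0 = p' 0) :
          c (T.directedEdge (i, p')) = c (T.directedEdge (i, p)) := by
        rcases perm_eq_of_zero_eq p p' h with rfl | rfl | rfl | rfl | rfl | rfl <;>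
          simp only [h13, h23]
      choose q hq using exists_perm_zero
      refine ⟨Quot.lift (fun a => c (T.directedEdge (a.1, q a.2))) ?_, ?_⟩
      · rintro ⟨i, v⟩ _ ⟨f, hf, rfl⟩
        obtain ⟨p, h0, h2⟩ := exists_perm_of_ne v f hf
        dsimp only
        rw [hall' i p (q v) (by rw [h0, hq]), hall' _ (T.perm i f * p) (q (T.perm i f v))
          (by rw [Equiv.Perm.mul_apply, h0, hq]), directedEdge_glue h2]
      · funext s
        exact hall' s.1 s.2 (q (s.2 0)) (by rw [hq])
    rw [← (LinearEquiv.finrank_eq (Submodule.equivMapOfInjective e he (LinearMap.ker g)).symm)]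
    refine (Submodule.finrank_mono hle).trans (m.finrank_range_le.trans ?_)
    rw [Module.finrank_fintype_fun_eq_card]
  have h1 := finrank_range_add_finrank_range_le f g hfg
  have h2 := f.finrank_range_add_finrank_ker
  have h3 := g.finrank_range_add_finrank_ker
  simp only [Module.finrank_fintype_fun_eq_card, Fintype.card_prod, Fintype.card_fin,
    Fintype.card_coe] at h1 h2 h3
  omega

end FaceGluing

/-- A quadrilateral type is given by either of its two pairs of vertices. -/
theorem quadType_perm : ∀ p : Equiv.Perm (Fin 4), quadType (p 1) (p 2) = quadType (p 0) (p 3) ∧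
    quadType (p 1) (p 3) = quadType (p 0) (p 2) := by
  decide

namespace FaceGluing

variable {n : ℕ} {T : FaceGluing n}

/-- The number of intersection points of a normal surface with the edge of a state. -/
def edgeWeight : ((Fin n × Fin 4 → ℝ) × QuadSpace n) →ₗ[ℝ] (Fin n × Equiv.Perm (Fin 4) → ℝ) where
  toFun y s := y.1 (s.1, s.2 0) + y.1 (s.1, s.2 1) + y.2 (s.1, quadType (s.2 0) (s.2 2)) +
    y.2 (s.1, quadType (s.2 0) (s.2 3))
  map_add' y z := by
    funext s; simp only [Prod.fst_add, Prod.snd_add, Pi.add_apply]; ring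
  map_smul' a y := by
    funext s
    simp only [Prod.smul_fst, Prod.smul_snd, Pi.smul_apply, smul_eq_mul, RingHom.id_apply]; ring

theorem edgeWeight_apply (y : (Fin n × Fin 4 → ℝ) × QuadSpace n)
    (s : Fin n × Equiv.Perm (Fin 4)) : edgeWeight y s = y.1 (s.1, s.2 0) + y.1 (s.1, s.2 1) +
      y.2 (s.1, quadType (s.2 0) (s.2 2)) + y.2 (s.1, quadType (s.2 0) (s.2 3)) := rfl

theorem edgeWeight_flip (y : (Fin n × Fin 4 → ℝ) × QuadSpace n)
    (s : Fin n × Equiv.Perm (Fin 4)) : edgeWeight y (flip s) = edgeWeight y s := by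
  simp only [edgeWeight_apply, flip_fst, flip_zero, flip_one, flip_two, flip_three]
  ring

theorem edgeWeight_rev (y : (Fin n × Fin 4 → ℝ) × QuadSpace n)
    (s : Fin n × Equiv.Perm (Fin 4)) : edgeWeight y (rev s) = edgeWeight y s := by
  simp only [edgeWeight_apply, rev_fst, rev_zero, rev_one, rev_two, rev_three, quadType_perm s.2]
  ring

theorem edgeWeight_step {y : (Fin n × Fin 4 → ℝ) × QuadSpace n} (hy : y ∈ T.standardSolutions)
    (s : Fin n × Equiv.Perm (Fin 4)) : edgeWeight y (T.step s) = edgeWeight y s := by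
  have h0 := hy s.1 (s.2 0) (s.2 2) (by simp)
  have h1 := hy s.1 (s.2 1) (s.2 2) (by simp)
  have h2 := (quadType_perm (T.step s).2).2
  rw [step_one, step_three] at h2
  rw [(quadType_perm s.2).1, h2] at h1
  simp only [edgeWeight_apply, step_fst]
  rw [step_three, step_zero, step_one]
  rw [step_zero] at h1
  linarith

theorem edgeWeight_eq_of_directedEdge_eq {y : (Fin n × Fin 4 → ℝ) × QuadSpace n}
    (hy : y ∈ T.standardSolutions) {s s' : Fin n × Equiv.Perm (Fin 4)}
    (h : T.directedEdge s = T.directedEdge s') : edgeWeight y s = edgeWeight y s' := by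
  have key {a b : Fin n × Equiv.Perm (Fin 4)} (h : T.step.SameCycle a b) :
      edgeWeight y a = edgeWeight y b := by
    obtain ⟨k, -, rfl⟩ := h.exists_pow_eq'
    clear h
    induction k with
    | zero => rfl
    | succ k ih => rw [pow_succ', Equiv.Perm.mul_apply, edgeWeight_step hy, ih]
  rcases Quotient.exact h with h | h
  · exact key h
  · rw [key h, edgeWeight_flip]

/-- In a tetrahedron, the sums of the weights of opposite edges determine the differences of the
quadrilateral coordinates. -/
theorem eq_zero_of_edgeWeight_eq_zero {y : (Fin n × Fin 4 → ℝ) × QuadSpace n}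
    (h : edgeWeight y = 0) (h0 : ∀ i, y.2 (i, 0) = 0) : y = 0 := by
  have key (i : Fin n) (a b c d : Fin 4)
      (hp : ∃ p : Equiv.Perm (Fin 4), p 0 = a ∧ p 1 = b ∧ p 2 = c ∧ p 3 = d) :
      y.1 (i, a) + y.1 (i, b) + y.2 (i, quadType a c) + y.2 (i, quadType a d) = 0 := by
    obtain ⟨p, rfl, rfl, rfl, rfl⟩ := hp
    exact congr_fun h (i, p)
  have hall (i : Fin n) : (∀ v, y.1 (i, v) = 0) ∧ ∀ j, y.2 (i, j) = 0 := by
    have e1 := key i 0 1 2 3 (by decide)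
    have e2 := key i 2 3 0 1 (by decide)
    have e3 := key i 0 2 1 3 (by decide)
    have e4 := key i 1 3 0 2 (by decide)
    have e5 := key i 0 3 1 2 (by decide)
    have e6 := key i 1 2 0 3 (by decide)
    have e0 := h0 i
    simp [quadType] at e1 e2 e3 e4 e5 e6
    rw [e0] at e3 e4 e5 e6
    have f1 : y.2 (i, 1) = 0 := by linarith
    have f2 : y.2 (i, 2) = 0 := by linarith
    rw [f1, f2] at e1 e2
    rw [f2] at e3 e4
    rw [f1] at e5 e6
    refine ⟨fun v => ?_, fun j => ?_⟩
    · fin_cases v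
      · change y.1 (i, 0) = 0
        linarith
      · change y.1 (i, 1) = 0
        linarith
      · change y.1 (i, 2) = 0
        linarith
      · change y.1 (i, 3) = 0
        linarith
    · fin_cases j
      exacts [e0, f1, f2]
  refine Prod.ext (funext fun c => (hall c.1).1 c.2) (funext fun k => (hall k.1).2 k.2)

/-- A solution of the standard matching equations is determined by its edge weights up to the
multiples of one vector per tetrahedron; half of the directed edges suffice. -/
theorem finrank_standardSolutions_le (hT : IsClosedThreeManifold T.Space) :
    2 * Module.finrank ℝ T.standardSolutions ≤ 2 * n + Fintype.card T.DirectedEdge := by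
  classical
  obtain ⟨R, hRc, hR⟩ := (DirectedEdge.rev_involutive (T := T)).exists_half
    (DirectedEdge.rev_ne hT)
  let L : ((Fin n × Fin 4 → ℝ) × QuadSpace n) →ₗ[ℝ] (Fin n → ℝ) × (R → ℝ) :=
    ((LinearMap.funLeft ℝ ℝ fun i => (i, 0)).comp (LinearMap.snd ℝ _ _)).prod
      ((LinearMap.funLeft ℝ ℝ fun e : R => Quotient.out (e : T.DirectedEdge)).comp edgeWeight)
  have hinj : Function.Injective (L.comp T.standardSolutions.subtype) := by
    rw [← LinearMap.ker_eq_bot, LinearMap.ker_eq_bot']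
    rintro ⟨y, hy⟩ h
    have h1 : ∀ i, y.2 (i, 0) = 0 := fun i => congr_fun (congr_arg Prod.fst h) i
    have h2 : ∀ e : R, edgeWeight y (Quotient.out (e : T.DirectedEdge)) = 0 := fun e =>
      congr_fun (congr_arg Prod.snd h) e
    have h3 (s : Fin n × Equiv.Perm (Fin 4)) (hs : T.directedEdge s ∈ R) : edgeWeight y s = 0 := by
      rw [← h2 ⟨_, hs⟩]
      exact edgeWeight_eq_of_directedEdge_eq hy (Quotient.out_eq _).symm
    refine Subtype.ext (eq_zero_of_edgeWeight_eq_zero (funext fun s => ?_) h1)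
    by_cases hs : T.directedEdge s ∈ R
    · exact h3 s hs
    · rw [← edgeWeight_rev]
      exact h3 _ ((hR _).1 hs)
  have h1 := LinearMap.finrank_le_finrank_of_injective hinj
  rw [Module.finrank_prod, Module.finrank_fintype_fun_eq_card, Module.finrank_fintype_fun_eq_card,
    Fintype.card_fin, Fintype.card_coe] at h1
  omega

/-- The vertex links are solutions of the standard matching equations without quadrilaterals. -/
theorem finrank_quadSolutions_add_card_vertex_le (hT : IsClosedThreeManifold T.Space) :
    Module.finrank ℝ T.quadSolutions + Fintype.card T.Vertex ≤
      Module.finrank ℝ T.standardSolutions := by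
  let q : T.standardSolutions →ₗ[ℝ] QuadSpace n :=
    (LinearMap.snd ℝ _ _).comp T.standardSolutions.subtype
  have h1 : T.quadSolutions ≤ LinearMap.range q := by
    rw [LinearMap.range_comp, Submodule.range_subtype]
    exact quadSolutions_le_map_standardSolutions hT
  let m : (T.Vertex → ℝ) →ₗ[ℝ] T.standardSolutions :=
    ((LinearMap.inl ℝ _ _).comp (LinearMap.funLeft ℝ ℝ (Quot.mk _))).codRestrict _ fun u => by
      intro i v f hvf
      have : (Quot.mk _ (i, v) : T.Vertex) = Quot.mk _ (T.adj i f, T.perm i f v) :=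
        Quot.sound ⟨f, hvf, rfl⟩
      simp [LinearMap.funLeft_apply, this]
  have hm : Function.Injective m := by
    intro u u' h
    have h2 := congr_arg (fun y => y.1.1) h
    exact LinearMap.funLeft_injective_of_surjective ℝ ℝ (Quot.mk _) Quot.mk_surjective h2
  have h2 : LinearMap.range m ≤ LinearMap.ker q := by
    rintro _ ⟨u, rfl⟩
    rfl
  have h3 := q.finrank_range_add_finrank_ker
  have h4 := Submodule.finrank_mono h1
  have h5 := Submodule.finrank_mono h2
  rw [LinearMap.finrank_range_of_inj hm, Module.finrank_fintype_fun_eq_card] at h5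
  omega

/-- The quadrilateral matching equations of a closed 3-manifold triangulation have a solution space
of dimension at most `2 n`. -/
theorem finrank_quadSolutions_le (hT : IsClosedThreeManifold T.Space) :
    Module.finrank ℝ T.quadSolutions ≤ 2 * n := by
  have h1 := finrank_standardSolutions_le hT
  have h2 := finrank_quadSolutions_add_card_vertex_le hT
  have h3 := card_directedEdge_le (T := T)
  omega

/-! ### Faces of the projective solution space -/

theorem convex_quadProjSolutionSpace : Convex ℝ T.quadProjSolutionSpace := by
  intro x hx y hy a b ha hb hab
  refine ⟨fun k => ?_, ?_, ?_⟩
  · have h1 := mul_nonneg ha (hx.1 k)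
    have h2 := mul_nonneg hb (hy.1 k)
    simpa using add_nonneg h1 h2
  · exact T.quadSolutions.add_mem (T.quadSolutions.smul_mem a hx.2.1)
      (T.quadSolutions.smul_mem b hy.2.1)
  · simp only [Pi.add_apply, Pi.smul_apply, smul_eq_mul, Finset.sum_add_distrib, ← Finset.mul_sum,
      hx.2.2, hy.2.2, mul_one, hab]

/-- An admissible face uses at most one quadrilateral type in each tetrahedron. -/
theorem IsAdmissibleFace.exists_quadType {F : Set (QuadSpace n)} (hF : T.IsAdmissibleFace F) :
    ∃ τ : Fin n → Fin 3, ∀ x ∈ F, ∀ i k, k ≠ τ i → x (i, k) = 0 := by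
  have key (i : Fin n) : ∃ j : Fin 3, ∀ x ∈ F, ∀ k, k ≠ j → x (i, k) = 0 := by
    by_cases h : ∃ x ∈ F, ∃ j, x (i, j) ≠ 0
    · obtain ⟨x, hx, j, hj⟩ := h
      refine ⟨j, fun y hy k hk => ?_⟩
      by_contra hne
      have hz : (1 / 2 : ℝ) • x + (1 / 2 : ℝ) • y ∈ F :=
        hF.1.convex convex_quadProjSolutionSpace hx hy (by norm_num) (by norm_num) (by norm_num)
      have hx0 := (hF.1.subset hx).1
      have hy0 := (hF.1.subset hy).1
      refine hk (hF.2 _ hz i k j ?_ ?_)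
      · have h1 := hx0 (i, k)
        have h2 := (hy0 (i, k)).lt_of_ne' hne
        simp only [Pi.add_apply, Pi.smul_apply, smul_eq_mul]
        linarith
      · have h1 := hy0 (i, j)
        have h2 := (hx0 (i, j)).lt_of_ne' hj
        simp only [Pi.add_apply, Pi.smul_apply, smul_eq_mul]
        linarith
    · push Not at h
      exact ⟨0, fun x hx k _ => h x hx k⟩
  choose τ hτ using key
  exact ⟨τ, fun x hx i k hk => hτ i x hx k hk⟩

/-- The vectors supported on the quadrilateral types `τ i`. -/
def coordinateMap (τ : Fin n → Fin 3) : (Fin n → ℝ) →ₗ[ℝ] QuadSpace n where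
  toFun c k := if k.2 = τ k.1 then c k.1 else 0
  map_add' c d := by
    funext k
    by_cases h : k.2 = τ k.1 <;> simp [h]
  map_smul' a c := by
    funext k
    by_cases h : k.2 = τ k.1 <;> simp [h]

theorem coordinateMap_injective (τ : Fin n → Fin 3) : Function.Injective (coordinateMap τ) := by
  intro c d h
  funext i
  simpa [coordinateMap] using congr_fun h (i, τ i)

/-- A face of dimension `n - 1` with quadrilateral types `τ` spans the whole coordinate subspace,
so every vector supported on the types `τ i` solves the matching equations. -/
theorem range_coordinateMap_le {F : Set (QuadSpace n)} (hF : T.IsAdmissibleFace F)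
    (hne : F.Nonempty) (hdim : convexDim F = (n : ℤ) - 1) {τ : Fin n → Fin 3}
    (hτ : ∀ x ∈ F, ∀ i k, k ≠ τ i → x (i, k) = 0) :
    LinearMap.range (coordinateMap τ) ≤ T.quadSolutions := by
  have hQ := hF.1.subset
  have h1 : Submodule.span ℝ F ≤ LinearMap.range (coordinateMap τ) := by
    rw [Submodule.span_le]
    intro x hx
    refine ⟨fun i => x (i, τ i), funext fun k => ?_⟩
    by_cases h : k.2 = τ k.1
    · simp [coordinateMap, ← h]
    · simp [coordinateMap, h, hτ x hx k.1 k.2 h]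
  have h2 : Submodule.span ℝ F ≤ T.quadSolutions :=
    Submodule.span_le.2 fun x hx => (hQ hx).2.1
  -- the coordinate sum is `1` on `F`, so the affine hull of `F` avoids the origin
  have h3 : vectorSpan ℝ F < Submodule.span ℝ F := by
    refine lt_of_le_of_ne ?_ fun h => ?_
    · rw [vectorSpan_def, Submodule.span_le]
      rintro _ ⟨x, hx, y, hy, rfl⟩
      exact Submodule.sub_mem _ (Submodule.subset_span hx) (Submodule.subset_span hy)
    · obtain ⟨x, hx⟩ := hne
      let σ : QuadSpace n →ₗ[ℝ] ℝ := ∑ k, LinearMap.proj k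
      have hσ (x) : σ x = ∑ k, x k := by simp [σ]
      have h4 : vectorSpan ℝ F ≤ LinearMap.ker σ := by
        rw [vectorSpan_def, Submodule.span_le]
        rintro _ ⟨x, hx, y, hy, rfl⟩
        change σ (x - y) = 0
        rw [map_sub, hσ, hσ, (hQ hx).2.2, (hQ hy).2.2, sub_self]
      have h5 : σ x = 0 := h4 (h ▸ Submodule.subset_span hx)
      rw [hσ, (hQ hx).2.2] at h5
      exact one_ne_zero h5
  have h4 : n ≤ Module.finrank ℝ (Submodule.span ℝ F) := by
    have h5 : Module.finrank ℝ (vectorSpan ℝ F) < Module.finrank ℝ (Submodule.span ℝ F) :=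
      Submodule.finrank_lt_finrank_of_lt h3
    have h6 : (Module.finrank ℝ (vectorSpan ℝ F) : ℤ) = n - 1 := by
      rw [convexDim, if_neg hne.ne_empty] at hdim
      rw [← direction_affineSpan]
      exact hdim
    omega
  have h5 : Submodule.span ℝ F = LinearMap.range (coordinateMap τ) := by
    refine Submodule.eq_of_le_of_finrank_le h1 ?_
    rw [LinearMap.finrank_range_of_inj (coordinateMap_injective τ),
      Module.finrank_fintype_fun_eq_card, Fintype.card_fin]
    exact h4
  rw [← h5]
  exact h2

theorem exists_two_ne : ∀ j : Fin 3, ∃ k l, k ≠ j ∧ l ≠ j ∧ k ≠ l := by decide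

/-- If all vectors supported on the types `τ i` are solutions, then together with the vectors
that are constant on each tetrahedron they exhaust the solution space.  So a solution takes equal
values on the two other quadrilateral types of a tetrahedron, and both vanish if it satisfies the
quadrilateral constraints. -/
theorem eq_zero_of_quadConstraints (hT : IsClosedThreeManifold T.Space) {τ : Fin n → Fin 3}
    (hτ : LinearMap.range (coordinateMap τ) ≤ T.quadSolutions) {x : QuadSpace n}
    (hx : T.MatchingEquations x) (hc : QuadConstraints x) (i : Fin n) (k : Fin 3) (hk : k ≠ τ i) :
    x (i, k) = 0 := by
  let m : ((Fin n → ℝ) × (Fin n → ℝ)) →ₗ[ℝ] QuadSpace n :=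
    (coordinateMap τ).coprod (LinearMap.funLeft ℝ ℝ Prod.fst)
  have hm (y : (Fin n → ℝ) × (Fin n → ℝ)) (i : Fin n) (k : Fin 3) (hk : k ≠ τ i) :
      m y (i, k) = y.2 i := by
    simp [m, coordinateMap, hk, LinearMap.funLeft_apply]
  have hinj : Function.Injective m := by
    rw [← LinearMap.ker_eq_bot, LinearMap.ker_eq_bot']
    rintro ⟨c, d⟩ h
    have hd : d = 0 := funext fun i => by
      obtain ⟨k, -, hk, -⟩ := exists_two_ne (τ i)
      have h1 := hm (c, d) i k hk
      rw [h] at h1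
      exact h1.symm
    subst hd
    have hc : coordinateMap τ c = coordinateMap τ 0 := by
      simpa [m] using h
    rw [coordinateMap_injective τ hc]
    rfl
  have hle : LinearMap.range m ≤ T.quadSolutions := by
    rintro _ ⟨⟨c, d⟩, rfl⟩
    rw [LinearMap.coprod_apply]
    refine T.quadSolutions.add_mem (hτ ⟨c, rfl⟩) fun s => ?_
    simp [slope, LinearMap.funLeft_apply]
  have heq : LinearMap.range m = T.quadSolutions := by
    refine Submodule.eq_of_le_of_finrank_le hle ?_
    rw [LinearMap.finrank_range_of_inj hinj, Module.finrank_prod,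
      Module.finrank_fintype_fun_eq_card, Fintype.card_fin, ← two_mul]
    exact finrank_quadSolutions_le hT
  obtain ⟨y, rfl⟩ : x ∈ LinearMap.range m := heq ▸ hx
  rw [hm y i k hk]
  by_contra hne
  obtain ⟨a, b, ha, hb, hab⟩ := exists_two_ne (τ i)
  exact hab (hc i a b (by rwa [hm y i a ha]) (by rwa [hm y i b hb]))

/-- The points of the projective solution space supported on the types `τ i` form an admissible
face, exposed by the sum of the other coordinates. -/
theorem isAdmissibleFace_of_quadType (τ : Fin n → Fin 3) :
    T.IsAdmissibleFace {x | x ∈ T.quadProjSolutionSpace ∧ ∀ i k, k ≠ τ i → x (i, k) = 0} := by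
  classical
  refine ⟨?_, fun x hx i j k hj hk => ?_⟩
  · rintro ⟨x₀, hx₀⟩
    set K : Finset (Fin n × Fin 3) := Finset.univ.filter fun k => k.2 ≠ τ k.1 with hK
    refine ⟨-∑ k ∈ K, ContinuousLinearMap.proj k, ?_⟩
    have hl (x : QuadSpace n) :
        (-∑ k ∈ K, (ContinuousLinearMap.proj k : QuadSpace n →L[ℝ] ℝ)) x = -∑ k ∈ K, x k := by
      simp
    have hz (x : QuadSpace n) (hx : ∀ i k, k ≠ τ i → x (i, k) = 0) : ∑ k ∈ K, x k = 0 :=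
      Finset.sum_eq_zero fun k hk => hx k.1 k.2 (Finset.mem_filter.1 hk).2
    ext x
    constructor
    · rintro ⟨hx, hxz⟩
      refine ⟨hx, fun y hy => ?_⟩
      rw [hl, hl, hz x hxz, neg_zero, neg_nonpos]
      exact Finset.sum_nonneg fun k _ => hy.1 k
    · rintro ⟨hx, hmax⟩
      have h1 := hmax x₀ hx₀.1
      rw [hl, hl, hz x₀ hx₀.2, neg_zero, neg_nonneg] at h1
      have h2 := (Finset.sum_eq_zero_iff_of_nonneg fun k _ => hx.1 k).1
        (le_antisymm h1 (Finset.sum_nonneg fun k _ => hx.1 k))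
      exact ⟨hx, fun i k hk => h2 (i, k) (by simpa [hK] using hk)⟩
  · have h1 : j = τ i := by_contra fun h => hj (hx.2 i j h)
    have h2 : k = τ i := by_contra fun h => hk (hx.2 i k h)
    rw [h1, h2]

end FaceGluing

theorem lemma5p3 {n : ℕ} (T : FaceGluing n) (hT : T.IsConnectedClosedTriangulation)
    (F : Set (QuadSpace n)) (hF : T.IsMaximalAdmissibleFace F)
    (hdim : convexDim F = (n : ℤ) - 1) :
    ∀ G : Set (QuadSpace n), T.IsMaximalAdmissibleFace G → G = F := by
  intro G hG
  rcases F.eq_empty_or_nonempty with rfl | hne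
  · -- the dimension `-1` of the empty face means that there are no tetrahedra
    rw [convexDim, if_pos rfl] at hdim
    obtain rfl : n = 0 := by omega
    refine Set.eq_empty_of_forall_notMem fun x hx => ?_
    have := (hG.prop.1.subset hx).2.2
    simp at this
  · obtain ⟨τ, hτ⟩ := hF.prop.exists_quadType
    have hle := FaceGluing.range_coordinateMap_le hF.prop hne hdim hτ
    have hFτ := hF.le_of_ge (FaceGluing.isAdmissibleFace_of_quadType τ)
      fun x hx => ⟨hF.prop.1.subset hx, hτ x hx⟩
    have hGF : G ⊆ F := fun x hx => hFτ ⟨hG.prop.1.subset hx, fun i k hk =>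
      FaceGluing.eq_zero_of_quadConstraints hT.1 hle (hG.prop.1.subset hx).2.1 (hG.prop.2 x hx)
        i k hk⟩
    exact hGF.antisymm (hG.le_of_ge hF.prop hGF)
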